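/- **Theorem (Wide Path Theorem).** Here a domain is a nonempty open connected subset of $\mathbb{R}^2$, a *square* is an open square in $\mathbb{R}^2$ of positive side length whose sides are parallel to the coordinate axes, and $\overline{E}$ denotes the closure of a set $E$ in $\mathbb{R}^2$. Let $\Omega\subset\mathbb{R}^2$ be a bounded simply connected domain, and let $x,y\in\Omega$. Then there exist an integer $k\ge 1$ and a finite family $S_1,S_2,\dots,S_k$ of pairwise disjoint squares contained in $\Omega$ such that: (i) $x\in S_1$ and $y\in\overline{S_k}$; (ii) $\overline{S_i}\cap\overline{S_{i+1}}\cap\Omega\neq\emptyset$ for all $i=1,\dots,k-1$, but $\overline{S_i}\cap\overline{S_j}\cap\Omega=\emptyset$ for all $1\le i,j\le k$ such that $|i-j|>1$; (iii) for every $i=2,\dots,k-1$ the open set $\Omega\setminus\overline{S_i}$ is not connected, and the sets $\bigcup_{1\le j<i}S_j$ and $\bigcup_{i<j\le k}S_j$ are contained in distinct connected components of $\Omega\setminus\overline{S_i}$. -/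

import Mathlib

/-- `S` is an open square in `ℝ²` (of positive side length `2 * r`, centered at `c`) whose sides
are parallel to the coordinate axes. -/
def IsOpenSquare (S : Set (ℝ × ℝ)) : Prop :=
  ∃ (c : ℝ × ℝ) (r : ℝ), 0 < r ∧
    S = Set.Ioo (c.1 - r) (c.1 + r) ×ˢ Set.Ioo (c.2 - r) (c.2 + r)

/-- `C` is a connected component of the set `A`. -/
def IsComponentOf {X : Type*} [TopologicalSpace X] (C A : Set X) : Prop :=
  ∃ a ∈ A, C = connectedComponentIn A a

/-!
Squares with sides parallel to the axes are the balls of the sup norm on `ℝ × ℝ`, and two such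
squares touch exactly when the distance of their centres is the sum of their radii.

The chain is built by iterating `exists_touching_square`, starting with the largest square in `Ω`
centred at `x`: if `y` is not in the closure of the current square `S`, there is a square `Q` in
`Ω` touching `S`, maximal in the sense that its closure leaves `Ω`, such that `y` is in the
closure of `Q` or `Q` separates `S` from `y`. That all the squares together satisfy the separation
properties follows formally (namespace `IsTouchingChain`), from the local fact that the complement
of a square is connected near each point (`isPreconnected_ball_diff_closedBall`). The iteration
stops (`exists_mem_closedBall_of_isTouchingChain`): a path from `x` to `y` has to meet the closures
of all the squares, which also leave `Ω`, so their sizes are bounded below.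

For `exists_touching_square`, consider the maximal arc of the boundary of `S` in `Ω` which is
accessible from `y`, and for each of its points the maximal square in `Ω` touching `S` there, with
centre on the ray from the centre of `S`. If none of these squares does what is wanted, then for
each of them `y` is still connected to the arc on one of the two sides of the contact point.

* This cannot be the case for both sides: the two connections would cross the crosscut of `Ω` which
  runs from a boundary point of `S` outside `Ω` through the contact point to a point outside `Ω` in
  the closure of the touching square. As `Ω` is simply connected, `(z - b) / (z - e)` has a
  continuous logarithm on `Ω`, where `b` and `e` are the end points of the crosscut, and this rules
  out such a crossing (`IsSimplyConnected.false_of_joined_across_crosscut`).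
* For either side, the set of contact points for which `y` is connected to the arc on that side is
  open, because the maximal touching squares are semicontinuous
  (`eventually_disjoint_touching_closedBall`).
* Neither of the two sets is the whole arc: near an end of the arc, a maximal touching square which
  is not small covers the rest of the arc, and a small one does not meet a given path from `y` to
  the arc (`not_forall_reaches_ahead`).

This contradicts the connectedness of the arc. The other use of simple connectedness is that `y`
reaches only one arc of the boundary of `S` in `Ω`
(`IsSimplyConnected.false_of_separated_inter`).
-/

open Set Filter Topology Metric

/-! ### Connected sets, components and first hitting times -/

theorem connectedComponentIn_eq_of_isPreconnected {X : Type*} [TopologicalSpace X] {F C : Set X}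
    {x y : X} (hC : IsPreconnected C) (hCF : C ⊆ F) (hx : x ∈ C) (hy : y ∈ C) :
    connectedComponentIn F x = connectedComponentIn F y :=
  connectedComponentIn_eq (hC.subset_connectedComponentIn hx hCF hy)

/-- In a joined set `F`, a path from `y` towards a closed set `K` can be stopped when it first
meets `K`. -/
theorem exists_isCompact_isPreconnected_first_hit {X : Type*} [TopologicalSpace X]
    {F K : Set X} (hK : IsClosed K) {y z₀ : X} (h : JoinedIn F y z₀) (hy : y ∉ K) (hz₀ : z₀ ∈ K) :
    ∃ C : Set X, ∃ z, IsCompact C ∧ IsPreconnected C ∧ C ⊆ F ∧ y ∈ C ∧ z ∈ C ∧ z ∈ K ∧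
      (∀ w ∈ C, w ∈ K → w = z) ∧ ∀ w ∈ C, w ∉ interior K := by
  set γ := h.somePath
  have hγ : Continuous γ.extend := γ.continuous_extend
  have hγF : ∀ t ∈ Icc (0 : ℝ) 1, γ.extend t ∈ F := by
    intro t ht
    rw [γ.extend_apply ht]
    exact h.somePath_mem _
  set T := Icc (0 : ℝ) 1 ∩ γ.extend ⁻¹' K
  have hT : IsCompact T := isCompact_Icc.inter_right (hK.preimage hγ)
  have hTne : T.Nonempty := ⟨1, by simp, by simpa using hz₀⟩
  have hτ : sInf T ∈ T := hT.sInf_mem hTne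
  set τ := sInf T
  have hlt : ∀ t, 0 ≤ t → t < τ → γ.extend t ∉ K := fun t h0 ht hk =>
    absurd (csInf_le hT.bddBelow ⟨⟨h0, ht.le.trans hτ.1.2⟩, hk⟩) (not_le.2 ht)
  have hτ0 : 0 < τ := by
    refine lt_of_le_of_ne hτ.1.1 fun h0 => hy ?_
    have := hτ.2
    rw [← h0] at this
    simpa using this
  refine ⟨γ.extend '' Icc 0 τ, γ.extend τ, isCompact_Icc.image hγ,
    isPreconnected_Icc.image _ hγ.continuousOn, ?_, ⟨0, ⟨le_rfl, hτ0.le⟩, by simp⟩,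
    ⟨τ, ⟨hτ0.le, le_rfl⟩, rfl⟩, hτ.2, ?_, ?_⟩
  · rintro _ ⟨t, ht, rfl⟩
    exact hγF t ⟨ht.1, ht.2.trans hτ.1.2⟩
  · rintro _ ⟨t, ht, rfl⟩ hk
    rcases ht.2.lt_or_eq with h' | rfl
    · exact absurd hk (hlt t ht.1 h')
    · rfl
  · rintro _ ⟨t, ht, rfl⟩ hk
    rcases ht.2.lt_or_eq with h' | rfl
    · exact absurd (interior_subset hk) (hlt t ht.1 h')
    · have h1 : ∀ᶠ s in 𝓝[<] τ, γ.extend s ∈ interior K :=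
        (hγ.continuousAt.eventually (isOpen_interior.mem_nhds hk)).filter_mono nhdsWithin_le_nhds
      have h2 : ∀ᶠ s in 𝓝[<] τ, s ∈ Ioo 0 τ := Ioo_mem_nhdsLT hτ0
      obtain ⟨s, hs1, hs2⟩ := (h1.and h2).exists
      exact hlt s hs2.1.le hs2.2 (interior_subset hs1)

/-! ### Simply connected sets and continuous logarithms -/

/-- Two continuous logarithms of the same function on a connected set differ by a constant. -/
theorem IsPreconnected.sub_eq_sub_of_exp_eq {X : Type*} [TopologicalSpace X] {s : Set X}
    (hs : IsPreconnected s) {f g : X → ℂ} (hf : ContinuousOn f s) (hg : ContinuousOn g s)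
    (h : ∀ x ∈ s, Complex.exp (f x) = Complex.exp (g x)) {a b : X} (ha : a ∈ s) (hb : b ∈ s) :
    f a - g a = f b - g b := by
  have hc : (Complex.exp ⁻¹' {1}).Countable := (countable_singleton _).preimage_cexp
  refine hc.isTotallyDisconnected _ ?_ (hs.image (f - g) (hf.sub hg)) ⟨a, ha, rfl⟩ ⟨b, hb, rfl⟩
  rintro _ ⟨x, hx, rfl⟩
  simp [Complex.exp_sub, h x hx]

/-- A simply connected open set is unicoherent: if it is covered by two closed sets `A` and `B`
whose intersection splits into the disjoint closed sets `K₁` and `K₂`, then a point of `K₁` cannot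
be connected to a point of `K₂` both within `A` and within `B`. Otherwise a function which turns
once around the circle between `K₁` and `K₂` on `A`, and is `1` on `B`, has no continuous
logarithm. -/
theorem IsSimplyConnected.false_of_separated_inter {X : Type*} [MetricSpace X]
    [LocallyPathConnectedSpace X] {Ω A B K₁ K₂ : Set X}
    (hsc : IsSimplyConnected Ω) (hΩ : IsOpen Ω) (hA : IsClosed A) (hB : IsClosed B)
    (hcov : Ω ⊆ A ∪ B) (hK₁ : IsClosed K₁) (hK₂ : IsClosed K₂)
    (hsub : Ω ∩ (A ∩ B) ⊆ K₁ ∪ K₂) (hdisj : Ω ∩ (K₁ ∩ K₂) = ∅) {C D : Set X}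
    (hC : IsPreconnected C) (hD : IsPreconnected D) (hCA : C ⊆ Ω ∩ A) (hDB : D ⊆ Ω ∩ B)
    {p q : X} (hp : p ∈ K₁) (hq : q ∈ K₂) (hpC : p ∈ C) (hqC : q ∈ C) (hpD : p ∈ D)
    (hqD : q ∈ D) : False := by
  classical
  set l : X → ℝ := fun z => infDist z K₁ / (infDist z K₁ + infDist z K₂)
  have hz₁ : ∀ z, infDist z K₁ = 0 ↔ z ∈ K₁ := fun z =>
    ⟨fun h => (hK₁.mem_iff_infDist_zero ⟨p, hp⟩).2 h,
      fun h => (hK₁.mem_iff_infDist_zero ⟨p, hp⟩).1 h⟩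
  have hz₂ : ∀ z, infDist z K₂ = 0 ↔ z ∈ K₂ := fun z =>
    ⟨fun h => (hK₂.mem_iff_infDist_zero ⟨q, hq⟩).2 h,
      fun h => (hK₂.mem_iff_infDist_zero ⟨q, hq⟩).1 h⟩
  have hden : ∀ z ∈ Ω, infDist z K₁ + infDist z K₂ ≠ 0 := by
    intro z hz h0
    have h1 : 0 ≤ infDist z K₁ := infDist_nonneg
    have h2 : 0 ≤ infDist z K₂ := infDist_nonneg
    have : z ∈ Ω ∩ (K₁ ∩ K₂) :=
      ⟨hz, (hz₁ z).1 (by linarith), (hz₂ z).1 (by linarith)⟩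
    rw [hdisj] at this
    exact this
  have hl : ContinuousOn l Ω := by
    apply ContinuousOn.div
    · exact (continuous_infDist_pt K₁).continuousOn
    · exact ((continuous_infDist_pt K₁).add (continuous_infDist_pt K₂)).continuousOn
    · exact hden
  have hl₁ : ∀ z ∈ K₁, l z = 0 := fun z hz => by simp [l, (hz₁ z).2 hz]
  have hl₂ : ∀ z ∈ Ω, z ∈ K₂ → l z = 1 := fun z hz hz2 => by
    have := hden z hz
    simp only [l, (hz₂ z).2 hz2, add_zero] at this ⊢
    exact div_self this
  set g : X → ℂ := fun z => 2 * Real.pi * Complex.I * (l z : ℂ)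
  have hg : ContinuousOn g Ω :=
    continuousOn_const.mul (Complex.continuous_ofReal.comp_continuousOn hl)
  set f : X → ℂ := fun z => if z ∈ A then Complex.exp (g z) else 1
  have hfA : ∀ z ∈ Ω ∩ A, f z = Complex.exp (g z) := fun z hz => if_pos hz.2
  have hfB : ∀ z ∈ Ω ∩ B, f z = 1 := by
    rintro z ⟨hz, hzB⟩
    by_cases hzA : z ∈ A
    · rw [hfA z ⟨hz, hzA⟩]
      rcases hsub ⟨hz, hzA, hzB⟩ with h | h
      · simp [g, hl₁ z h]
      · simp [g, hl₂ z hz h, Complex.exp_two_pi_mul_I]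
    · exact if_neg hzA
  have hf : ContinuousOn f Ω := by
    intro z hz
    have e : Ω = (Ω ∩ A) ∪ (Ω ∩ B) := by
      rw [← inter_union_distrib_left, inter_eq_left.2 hcov]
    rw [e]
    refine ContinuousWithinAt.union ?_ ?_
    · by_cases hzA : z ∈ A
      · exact ((Complex.continuous_exp.comp_continuousOn (hg.mono inter_subset_left)) z
          ⟨hz, hzA⟩).congr hfA (hfA z ⟨hz, hzA⟩)
      · refine continuousWithinAt_of_notMem_closure fun h => hzA ?_
        exact hA.closure_subset (closure_mono inter_subset_right h)
    · by_cases hzB : z ∈ B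
      · exact (continuousWithinAt_const (b := (1 : ℂ))).congr hfB (hfB z ⟨hz, hzB⟩)
      · refine continuousWithinAt_of_notMem_closure fun h => hzB ?_
        exact hB.closure_subset (closure_mono inter_subset_right h)
  have hf0 : (0 : ℂ) ∉ f '' Ω := by
    rintro ⟨z, hz, h0⟩
    by_cases hzA : z ∈ A
    · rw [hfA z ⟨hz, hzA⟩] at h0
      exact Complex.exp_ne_zero _ h0
    · rw [hfB z ⟨hz, (hcov hz).resolve_left hzA⟩] at h0
      exact one_ne_zero h0
  obtain ⟨h, hh, hfh⟩ := Complex.exists_continuousOn_eqOn_exp_comp hsc hΩ hf hf0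
  have h1 := hC.sub_eq_sub_of_exp_eq (hh.mono (hCA.trans inter_subset_left))
    (hg.mono (hCA.trans inter_subset_left))
    (fun z hz => by rw [← hfA z (hCA hz), ← hfh (hCA hz).1]; rfl) hpC hqC
  have h2 := hD.sub_eq_sub_of_exp_eq (hh.mono (hDB.trans inter_subset_left))
    (continuousOn_const (c := (0 : ℂ)))
    (fun z hz => by rw [Complex.exp_zero, ← hfB z (hDB hz), ← hfh (hDB hz).1]; rfl) hpD hqD
  have h3 : g p = g q := by linear_combination h2 - h1
  simp [g, hl₁ p hp, hl₂ q (hCA hqC).1 hq, Real.pi_ne_zero] at h3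

/-! ### Squares as balls of the sup norm -/

/-- The corner `p + (± η, ± η)` of the square of centre `p` and radius `η` which points away from
`c`. -/
noncomputable def outerCorner (p c : ℝ × ℝ) (η : ℝ) : ℝ × ℝ :=
  (p.1 + (if c.1 ≤ p.1 then 1 else -1) * η, p.2 + (if c.2 ≤ p.2 then 1 else -1) * η)

theorem segment_outerCorner_subset {p c a : ℝ × ℝ} {ε r η : ℝ} (hε : ε ≤ r) (hη : η < ε)
    (ha : dist a p ≤ η) (hac : a ∉ closedBall c r) :
    segment ℝ a (outerCorner p c η) ⊆ ball p ε \ closedBall c r := by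
  have hη0 : 0 ≤ η := dist_nonneg.trans ha
  have ha1 : |a.1 - p.1| ≤ η ∧ |a.2 - p.2| ≤ η := by
    rwa [Prod.dist_eq, max_le_iff, Real.dist_eq, Real.dist_eq] at ha
  rw [abs_le, abs_le] at ha1
  set q := outerCorner p c η
  have hq : q ∈ ball p ε := by
    rw [mem_ball, Prod.dist_eq, max_lt_iff, Real.dist_eq, Real.dist_eq]
    simp only [q, outerCorner]
    constructor <;> split_ifs <;> simp [abs_of_nonneg hη0, hη]
  have hb : segment ℝ a q ⊆ ball p ε :=
    (convex_ball p ε).segment_subset (mem_ball.2 (ha.trans_lt hη)) hq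
  have key : (∀ z ∈ segment ℝ a q, c.1 + r < z.1) ∨ (∀ z ∈ segment ℝ a q, z.1 < c.1 - r) ∨
      (∀ z ∈ segment ℝ a q, c.2 + r < z.2) ∨ (∀ z ∈ segment ℝ a q, z.2 < c.2 - r) := by
    rw [mem_closedBall, Prod.dist_eq, max_le_iff, Real.dist_eq, Real.dist_eq, not_and_or, not_le,
      not_le, lt_abs, lt_abs] at hac
    rcases hac with (h | h) | (h | h)
    · refine Or.inl fun z hz => ?_
      refine ((convex_Ioi (c.1 + r)).is_linear_preimage
        (LinearMap.isLinear (LinearMap.fst ℝ ℝ ℝ))).segment_subset ?_ ?_ hz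
      · change c.1 + r < a.1; linarith
      · change c.1 + r < q.1
        simp only [q, outerCorner]; split_ifs <;> linarith
    · refine Or.inr (Or.inl fun z hz => ?_)
      refine ((convex_Iio (c.1 - r)).is_linear_preimage
        (LinearMap.isLinear (LinearMap.fst ℝ ℝ ℝ))).segment_subset ?_ ?_ hz
      · change a.1 < c.1 - r; linarith
      · change q.1 < c.1 - r
        simp only [q, outerCorner]; split_ifs <;> linarith
    · refine Or.inr (Or.inr (Or.inl fun z hz => ?_))
      refine ((convex_Ioi (c.2 + r)).is_linear_preimage
        (LinearMap.isLinear (LinearMap.snd ℝ ℝ ℝ))).segment_subset ?_ ?_ hz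
      · change c.2 + r < a.2; linarith
      · change c.2 + r < q.2
        simp only [q, outerCorner]; split_ifs <;> linarith
    · refine Or.inr (Or.inr (Or.inr fun z hz => ?_))
      refine ((convex_Iio (c.2 - r)).is_linear_preimage
        (LinearMap.isLinear (LinearMap.snd ℝ ℝ ℝ))).segment_subset ?_ ?_ hz
      · change a.2 < c.2 - r; linarith
      · change q.2 < c.2 - r
        simp only [q, outerCorner]; split_ifs <;> linarith
  intro z hz
  refine ⟨hb hz, fun hzc => ?_⟩
  rw [mem_closedBall, Prod.dist_eq, max_le_iff, Real.dist_eq, Real.dist_eq, abs_le, abs_le] at hzc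
  rcases key with h | h | h | h <;> linarith [h z hz, hzc.1.1, hzc.1.2, hzc.2.1, hzc.2.2]

theorem isPreconnected_ball_diff_closedBall (p c : ℝ × ℝ) {ε r : ℝ} (hε : ε ≤ r) :
    IsPreconnected (ball p ε \ closedBall c r) := by
  refine isPreconnected_of_forall_pair fun a ha b hb => ?_
  have hη : max (dist a p) (dist b p) < ε := max_lt ha.1 hb.1
  set q := outerCorner p c (max (dist a p) (dist b p))
  refine ⟨segment ℝ a q ∪ segment ℝ b q, union_subset
    (segment_outerCorner_subset hε hη (le_max_left _ _) ha.2)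
    (segment_outerCorner_subset hε hη (le_max_right _ _) hb.2),
    Or.inl (left_mem_segment _ _ _), Or.inr (left_mem_segment _ _ _), ?_⟩
  exact (convex_segment a q).isPreconnected.union q (right_mem_segment _ _ _)
    (right_mem_segment _ _ _) (convex_segment b q).isPreconnected

/-- Near a point of an open set `Ω`, the complement of a square is connected, so connected subsets
of `Ω` outside a square which accumulate at the same point of `Ω` lie in the same component. -/
theorem connectedComponentIn_eq_of_mem_closure {Ω X Y : Set (ℝ × ℝ)} (hΩ : IsOpen Ω)
    {c p x y : ℝ × ℝ} {r : ℝ} (hr : 0 < r) (hX : IsPreconnected X) (hY : IsPreconnected Y)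
    (hXΩ : X ⊆ Ω \ closedBall c r) (hYΩ : Y ⊆ Ω \ closedBall c r) (hp : p ∈ Ω)
    (hpX : p ∈ closure X) (hpY : p ∈ closure Y) (hx : x ∈ X) (hy : y ∈ Y) :
    connectedComponentIn (Ω \ closedBall c r) x = connectedComponentIn (Ω \ closedBall c r) y := by
  obtain ⟨ε, hε, hεΩ⟩ := Metric.isOpen_iff.1 hΩ p hp
  set δ := min ε r
  have hδ : 0 < δ := lt_min hε hr
  set N := ball p δ \ closedBall c r
  have hN : IsPreconnected N := isPreconnected_ball_diff_closedBall p c (min_le_right _ _)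
  have hNΩ : N ⊆ Ω \ closedBall c r :=
    sdiff_subset_sdiff_left ((ball_subset_ball (min_le_left _ _)).trans hεΩ)
  obtain ⟨x', hx'X, hx'⟩ := Metric.mem_closure_iff.1 hpX δ hδ
  obtain ⟨y', hy'Y, hy'⟩ := Metric.mem_closure_iff.1 hpY δ hδ
  rw [dist_comm] at hx' hy'
  exact ((connectedComponentIn_eq_of_isPreconnected hX hXΩ hx hx'X).trans
    (connectedComponentIn_eq_of_isPreconnected hN hNΩ ⟨hx', (hXΩ hx'X).2⟩
      ⟨hy', (hYΩ hy'Y).2⟩)).trans (connectedComponentIn_eq_of_isPreconnected hY hYΩ hy'Y hy)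

/-! ### The boundary of a square in polar coordinates -/

/-- The point of the boundary of the square `[-1, 1] × [-1, 1]` with polar angle `t`. -/
noncomputable def squareDir (t : ℝ) : ℝ × ℝ :=
  ‖(Real.cos t, Real.sin t)‖⁻¹ • (Real.cos t, Real.sin t)

theorem norm_cos_sin_pos (t : ℝ) : 0 < ‖(Real.cos t, Real.sin t)‖ := by
  rw [norm_pos_iff]
  intro h
  have h1 := Real.sin_sq_add_cos_sq t
  simp [(Prod.mk.inj h).1, (Prod.mk.inj h).2] at h1

theorem norm_squareDir (t : ℝ) : ‖squareDir t‖ = 1 := by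
  rw [squareDir, norm_smul, norm_inv, norm_norm, inv_mul_cancel₀ (norm_cos_sin_pos t).ne']

theorem continuous_squareDir : Continuous squareDir := by
  have h : Continuous fun t : ℝ => (Real.cos t, Real.sin t) :=
    Real.continuous_cos.prodMk Real.continuous_sin
  exact (h.norm.inv₀ fun t => (norm_cos_sin_pos t).ne').smul h

theorem squareDir_add_two_pi (t : ℝ) : squareDir (t + 2 * Real.pi) = squareDir t := by
  simp [squareDir]

theorem squareDir_neg (t : ℝ) : squareDir (-t) = ((squareDir t).1, -(squareDir t).2) := by
  simp [squareDir, Prod.norm_def]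

theorem squareDir_add_pi_div_two (t : ℝ) :
    squareDir (t + Real.pi / 2) = (-(squareDir t).2, (squareDir t).1) := by
  simp [squareDir, Real.cos_add_pi_div_two, Real.sin_add_pi_div_two, Prod.norm_def, max_comm]

theorem squareDir_complex (t : ℝ) :
    ((squareDir t).1 : ℂ) + (squareDir t).2 * Complex.I =
      (‖(Real.cos t, Real.sin t)‖⁻¹ : ℝ) * Complex.exp (t * Complex.I) := by
  rw [Complex.exp_mul_I]
  simp only [squareDir, Prod.smul_fst, Prod.smul_snd, smul_eq_mul]
  push_cast
  ring

theorem exists_squareDir_eq {v : ℝ × ℝ} (hv : ‖v‖ = 1) (a : ℝ) :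
    ∃ t ∈ Ico a (a + 2 * Real.pi), squareDir t = v := by
  obtain ⟨t, ht⟩ : ∃ t, squareDir t = v := by
    set z : ℂ := ⟨v.1, v.2⟩
    have hz : z ≠ 0 := by
      intro h
      have h1 : v.1 = 0 := congrArg Complex.re h
      have h2 : v.2 = 0 := congrArg Complex.im h
      rw [Prod.norm_def, h1, h2] at hv
      simp at hv
    have hz' : 0 < ‖z‖ := norm_pos_iff.2 hz
    refine ⟨z.arg, ?_⟩
    have h1 : (Real.cos z.arg, Real.sin z.arg) = ‖z‖⁻¹ • v := by
      rw [Complex.cos_arg hz, Complex.sin_arg]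
      ext <;> simp [z, div_eq_inv_mul]
    rw [squareDir, h1, norm_smul, hv, smul_smul]
    simp [hz'.ne']
  refine ⟨toIcoMod Real.two_pi_pos a t, toIcoMod_mem_Ico Real.two_pi_pos a t, ?_⟩
  rw [← ht]
  have hp : Function.Periodic squareDir (2 * Real.pi) := squareDir_add_two_pi
  rw [toIcoMod]
  exact hp.sub_zsmul_eq _

theorem squareDir_injective_of_abs_sub_lt {s t : ℝ} (h : squareDir s = squareDir t)
    (hst : |s - t| < 2 * Real.pi) : s = t := by
  have h1 := squareDir_complex s
  rw [h, squareDir_complex t] at h1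
  have h2 := congrArg Complex.arg h1
  rw [Complex.arg_real_mul _ (inv_pos.2 (norm_cos_sin_pos t)),
    Complex.arg_real_mul _ (inv_pos.2 (norm_cos_sin_pos s)), Complex.arg_exp_mul_I,
    Complex.arg_exp_mul_I] at h2
  rw [toIocMod_eq_toIocMod] at h2
  obtain ⟨n, hn⟩ := h2
  have hn' : s - t = n * (2 * Real.pi) := by simpa using hn
  rw [hn', abs_mul, abs_of_pos Real.two_pi_pos] at hst
  have h3 : |(n : ℝ)| < 1 := by
    by_contra! h3
    nlinarith [Real.two_pi_pos]
  have h4 : n = 0 := by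
    rw [← Int.abs_lt_one_iff]
    exact_mod_cast h3
  rw [h4] at hn'
  simp at hn'
  linarith

/-! ### Squares touching a given square -/

theorem dist_touching_centers (c v : ℝ × ℝ) (hv : ‖v‖ = 1) (a b : ℝ) :
    dist (c + a • v) (c + b • v) = |a - b| := by
  rw [dist_add_left, dist_eq_norm, ← sub_smul, norm_smul, hv, mul_one, Real.norm_eq_abs]

theorem dist_touching_center (c v : ℝ × ℝ) (hv : ‖v‖ = 1) {a : ℝ} (ha : 0 ≤ a) :
    dist c (c + a • v) = a := by
  rw [dist_self_add_right, norm_smul, hv, mul_one, Real.norm_eq_abs, abs_of_nonneg ha]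

/-- The squares which touch the square of centre `c` and radius `r` at `c + r • v` and whose
centre is in the direction of `v` increase with their radius. -/
theorem touching_ball_mono (c v : ℝ × ℝ) (hv : ‖v‖ = 1) (r : ℝ) {a b : ℝ} (hab : a ≤ b) :
    ball (c + (r + a) • v) a ⊆ ball (c + (r + b) • v) b := by
  refine ball_subset_ball' ?_
  rw [dist_touching_centers c v hv, abs_of_nonpos (by linarith)]
  linarith

theorem exists_maximal_touching_radius {Ω : Set (ℝ × ℝ)} (hΩ : IsOpen Ω)
    (hbdd : Bornology.IsBounded Ω) {c v : ℝ × ℝ} (hv : ‖v‖ = 1) {r : ℝ} (hr : 0 < r)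
    (hmem : c + r • v ∈ Ω) :
    ∃ R, 0 < R ∧ ball (c + (r + R) • v) R ⊆ Ω ∧ ¬ closedBall (c + (r + R) • v) R ⊆ Ω ∧
      ∀ ρ, ball (c + (r + ρ) • v) ρ ⊆ Ω → ρ ≤ R := by
  obtain ⟨ε, hε, hεΩ⟩ := Metric.isOpen_iff.1 hΩ _ hmem
  obtain ⟨M, hM⟩ := hbdd.subset_closedBall c
  set T := {ρ : ℝ | ball (c + (r + ρ) • v) ρ ⊆ Ω}
  have hT0 : ε / 2 ∈ T := by
    refine Subset.trans (ball_subset_ball' ?_) hεΩ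
    rw [dist_touching_centers c v hv, abs_of_nonneg (by linarith)]
    linarith
  have hbd : BddAbove T := by
    refine ⟨max M 0, fun ρ hρ => ?_⟩
    rcases le_or_gt ρ 0 with h0 | h0
    · exact h0.trans (le_max_right _ _)
    · have h1 := hM (hρ (mem_ball_self h0))
      rw [mem_closedBall, dist_comm, dist_touching_center c v hv (by linarith)] at h1
      exact le_trans (by linarith) (le_max_left _ _)
  set R := sSup T
  have hR : 0 < R := lt_of_lt_of_le (by linarith) (le_csSup hbd hT0)
  refine ⟨R, hR, ?_, ?_, fun ρ hρ => le_csSup hbd hρ⟩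
  · intro w hw
    rw [mem_ball] at hw
    set d := dist w (c + (r + R) • v)
    obtain ⟨ρ, hρT, hρ⟩ := exists_lt_of_lt_csSup ⟨_, hT0⟩ (show R - (R - d) / 2 < R by linarith)
    have hρR : ρ ≤ R := le_csSup hbd hρT
    refine hρT ?_
    rw [mem_ball]
    have := dist_triangle w (c + (r + R) • v) (c + (r + ρ) • v)
    rw [dist_touching_centers c v hv, abs_of_nonneg (by linarith)] at this
    linarith
  · intro hsub
    obtain ⟨δ, hδ, hδΩ⟩ := (isCompact_closedBall _ _).exists_thickening_subset_open hΩ hsub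
    rw [thickening_closedBall hδ hR.le] at hδΩ
    have : R + δ / 2 ∈ T := by
      refine Subset.trans (ball_subset_ball' ?_) hδΩ
      rw [dist_touching_centers c v hv, abs_of_nonneg (by linarith)]
      linarith
    linarith [le_csSup hbd this]

/-- Semicontinuity of the maximal touching squares: if the compact set `C` does not meet the
closure of the maximal touching square in direction `v`, then the same holds for all touching
squares in nearby directions. -/
theorem eventually_disjoint_touching_closedBall {Ω C : Set (ℝ × ℝ)} {c v : ℝ × ℝ} {r R : ℝ}
    (hv : ‖v‖ = 1) (hmax : ∀ ρ, ball (c + (r + ρ) • v) ρ ⊆ Ω → ρ ≤ R) (hC : IsCompact C)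
    (hdisj : Disjoint C (closedBall (c + (r + R) • v) R)) :
    ∀ᶠ v' in 𝓝 v, ‖v'‖ = 1 → ∀ ρ, ball (c + (r + ρ) • v') ρ ⊆ Ω →
      Disjoint C (closedBall (c + (r + ρ) • v') ρ) := by
  obtain ⟨δ, hδ, hCδ⟩ : ∃ δ > 0, ∀ p ∈ C, R + δ ≤ dist p (c + (r + R) • v) := by
    rcases C.eq_empty_or_nonempty with rfl | hne
    · exact ⟨1, one_pos, by simp⟩
    · obtain ⟨p, hp, hmin⟩ := hC.exists_isMinOn hne
        (f := fun p => dist p (c + (r + R) • v)) (by fun_prop)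
      have hp' : R < dist p (c + (r + R) • v) := by
        simpa using disjoint_left.1 hdisj hp
      exact ⟨dist p (c + (r + R) • v) - R, by linarith, fun w hw => by
        have : dist p (c + (r + R) • v) ≤ dist w (c + (r + R) • v) := hmin hw
        linarith⟩
  set ε := δ / 4
  have hε : 0 < ε := by positivity
  have hnot : ¬ ball (c + (r + (R + ε)) • v) (R + ε) ⊆ Ω := fun h => by linarith [hmax _ h]
  obtain ⟨q, hq, hqΩ⟩ := not_subset.1 hnot
  have h1 : ∀ᶠ v' in 𝓝 v, dist q (c + (r + (R + ε)) • v') < R + ε := by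
    have : Continuous fun v' : ℝ × ℝ => dist q (c + (r + (R + ε)) • v') := by fun_prop
    exact this.continuousAt.eventually (gt_mem_nhds hq)
  have h2 : ∀ᶠ v' in 𝓝 v, dist (c + (r + (R + ε)) • v') (c + (r + (R + ε)) • v) < ε := by
    have : Continuous fun v' : ℝ × ℝ => dist (c + (r + (R + ε)) • v') (c + (r + (R + ε)) • v) := by
      fun_prop
    exact this.continuousAt.eventually (gt_mem_nhds (by simpa using hε))
  filter_upwards [h1, h2] with v' h1 h2 hv' ρ hρ
  have hρR : ρ < R + ε := by
    by_contra! hle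
    exact hqΩ (hρ (touching_ball_mono c v' hv' r hle h1))
  rw [disjoint_left]
  intro p hp hpb
  rw [mem_closedBall] at hpb
  have e1 := dist_triangle p (c + (r + ρ) • v') (c + (r + (R + ε)) • v')
  rw [dist_touching_centers c v' hv', abs_of_nonpos (by linarith)] at e1
  have e2 := dist_triangle p (c + (r + (R + ε)) • v') (c + (r + (R + ε)) • v)
  have e3 := dist_triangle p (c + (r + (R + ε)) • v) (c + (r + R) • v)
  rw [dist_touching_centers c v hv, abs_of_nonneg (by linarith)] at e3
  have e4 := hCδ p hp
  have : ε = δ / 4 := rfl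
  linarith

/-- For a parametrisation `u` of the boundary of the unit square: a touching square of radius at
least `ρ` whose contact point `r • u t` comes just before `r • u β` covers, with its
closure, the part of the boundary of the square of radius `r` between these two points. -/
def CoversUpTo (u : ℝ → ℝ × ℝ) (β : ℝ) : Prop :=
  ∀ r > 0, ∀ ρ > 0, ∀ᶠ t in 𝓝[<] β, ∀ s ∈ Icc t β, ∀ R ≥ ρ, ‖r • u s - (r + R) • u t‖ ≤ R

theorem squareDir_of_abs_le {t : ℝ} (h1 : -(Real.pi / 4) ≤ t) (h2 : t ≤ Real.pi / 4) :
    squareDir t = (1, Real.tan t) := by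
  have hpi := Real.pi_pos
  have hc : 0 < Real.cos t := Real.cos_pos_of_mem_Ioo ⟨by linarith, by linarith⟩
  have e : Real.sin t = Real.tan t * Real.cos t := (Real.tan_mul_cos hc.ne').symm
  have ht1 : Real.tan t ≤ 1 := by
    rw [← Real.tan_pi_div_four]
    exact Real.strictMonoOn_tan.monotoneOn ⟨by linarith, by linarith⟩ ⟨by linarith, by linarith⟩ h2
  have ht2 : -1 ≤ Real.tan t := by
    rw [← Real.tan_pi_div_four, ← Real.tan_neg]
    exact Real.strictMonoOn_tan.monotoneOn ⟨by linarith, by linarith⟩ ⟨by linarith, by linarith⟩ h1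
  have hn : ‖(Real.cos t, Real.sin t)‖ = Real.cos t := by
    rw [Prod.norm_mk, Real.norm_eq_abs, Real.norm_eq_abs, abs_of_pos hc, max_eq_left]
    rw [e, abs_mul, abs_of_pos hc]
    exact mul_le_of_le_one_left hc.le (abs_le.2 ⟨ht2, ht1⟩)
  rw [squareDir, hn, e]
  ext
  · simp [hc.ne']
  · simp only [Prod.smul_snd, smul_eq_mul]
    field_simp

theorem coversUpTo_squareDir_of_mem_Ioc {β : ℝ} (hβ : β ∈ Ioc (-(Real.pi / 4)) (Real.pi / 4)) :
    CoversUpTo squareDir β := by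
  intro r hr ρ hρ
  have hpi := Real.pi_pos
  have hm : ∀ x : ℝ, -(Real.pi / 4) ≤ x → x ≤ Real.pi / 4 →
      x ∈ Ioo (-(Real.pi / 2)) (Real.pi / 2) := fun x h1 h2 => ⟨by linarith, by linarith⟩
  have hβm := hm β hβ.1.le hβ.2
  have htan : ContinuousAt Real.tan β :=
    Real.continuousAt_tan.2 (Real.cos_pos_of_mem_Ioo hβm).ne'
  have hβ1 : -1 < Real.tan β := by
    rw [← Real.tan_pi_div_four, ← Real.tan_neg]
    exact Real.strictMonoOn_tan (hm _ le_rfl (by linarith)) hβm hβ.1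
  have hev : ∀ᶠ t in 𝓝 β, r * (Real.tan β - Real.tan t) - ρ * (1 + Real.tan t) < 0 := by
    have hcont : ContinuousAt
        (fun t => r * (Real.tan β - Real.tan t) - ρ * (1 + Real.tan t)) β := by fun_prop
    refine hcont.eventually (gt_mem_nhds ?_)
    have : 0 < ρ * (1 + Real.tan β) := mul_pos hρ (by linarith)
    simp only [sub_self, mul_zero]
    linarith
  filter_upwards [hev.filter_mono nhdsWithin_le_nhds, Ioo_mem_nhdsLT hβ.1] with t ht htβ s hs R hR
  have ht1 := htβ.1.le
  have ht2 : t ≤ Real.pi / 4 := htβ.2.le.trans hβ.2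
  have hs1 : -(Real.pi / 4) ≤ s := ht1.trans hs.1
  have hs2 : s ≤ Real.pi / 4 := hs.2.trans hβ.2
  have m1 : Real.tan t ≤ Real.tan s :=
    Real.strictMonoOn_tan.monotoneOn (hm t ht1 ht2) (hm s hs1 hs2) hs.1
  have m2 : Real.tan s ≤ Real.tan β :=
    Real.strictMonoOn_tan.monotoneOn (hm s hs1 hs2) hβm hs.2
  have m3 : Real.tan t ≤ 1 := by
    rw [← Real.tan_pi_div_four]
    exact Real.strictMonoOn_tan.monotoneOn (hm t ht1 ht2) (hm _ (by linarith) le_rfl) ht2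
  have hR0 : 0 < R := hρ.trans_le hR
  have p1 : 0 ≤ r * (Real.tan s - Real.tan t) := mul_nonneg hr.le (by linarith)
  have p2 : 0 ≤ r * (Real.tan β - Real.tan s) := mul_nonneg hr.le (by linarith)
  have p3 : 0 < 1 + Real.tan t := by
    by_contra! h
    have := mul_nonneg_of_nonpos_of_nonpos (show -ρ ≤ 0 by linarith) h
    nlinarith
  have p4 : ρ * (1 + Real.tan t) ≤ R * (1 + Real.tan t) := mul_le_mul_of_nonneg_right hR p3.le
  have p5 : 0 ≤ R * (1 - Real.tan t) := mul_nonneg hR0.le (by linarith)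
  rw [squareDir_of_abs_le ht1 ht2, squareDir_of_abs_le hs1 hs2, Prod.norm_def, max_le_iff]
  simp only [Prod.smul_mk, smul_eq_mul, Prod.mk_sub_mk, Real.norm_eq_abs, mul_one, abs_le]
  refine ⟨⟨by linarith, by linarith⟩, ?_, ?_⟩ <;> nlinarith

theorem CoversUpTo.add_pi_div_two {β : ℝ} (h : CoversUpTo squareDir β) :
    CoversUpTo squareDir (β + Real.pi / 2) := by
  intro r hr ρ hρ
  have hmap : Tendsto (fun t => t - Real.pi / 2) (𝓝[<] (β + Real.pi / 2)) (𝓝[<] β) := by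
    refine tendsto_nhdsWithin_iff.2 ⟨?_, ?_⟩
    · have : ContinuousAt (fun t : ℝ => t - Real.pi / 2) (β + Real.pi / 2) := by fun_prop
      simpa [ContinuousAt] using this.tendsto.mono_left nhdsWithin_le_nhds
    · filter_upwards [self_mem_nhdsWithin] with t ht
      simp only [mem_Iio] at ht ⊢
      linarith
  filter_upwards [hmap.eventually (h r hr ρ hρ)] with t ht s hs R hR
  have h1 := ht (s - Real.pi / 2) ⟨by linarith [hs.1], by linarith [hs.2]⟩ R hR
  have e : ∀ x, squareDir x =
      (-(squareDir (x - Real.pi / 2)).2, (squareDir (x - Real.pi / 2)).1) := fun x => by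
    rw [← squareDir_add_pi_div_two, sub_add_cancel]
  rw [e s, e t]
  rw [Prod.norm_def] at h1 ⊢
  simp only [Prod.fst_sub, Prod.snd_sub, Prod.smul_fst, Prod.smul_snd, smul_eq_mul,
    Real.norm_eq_abs, max_le_iff] at h1 ⊢
  refine ⟨?_, h1.1⟩
  rw [← abs_neg]
  convert h1.2 using 2
  ring

/-- By rotational symmetry the angle `β` may be assumed to lie on the right side of the square,
its lower end point excluded. -/
theorem coversUpTo_squareDir (β : ℝ) : CoversUpTo squareDir β := by
  have hp : 0 < Real.pi / 2 := by positivity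
  have hper : ∀ γ, CoversUpTo squareDir γ → ∀ n : ℕ,
      CoversUpTo squareDir (γ + n * (Real.pi / 2)) := by
    intro γ hγ n
    induction n with
    | zero => simpa using hγ
    | succ n ih =>
      have := ih.add_pi_div_two
      convert this using 1
      push_cast
      ring
  have hmod := toIocMod_mem_Ioc hp (-(Real.pi / 4)) β
  rw [show -(Real.pi / 4) + Real.pi / 2 = Real.pi / 4 by ring] at hmod
  have hb := coversUpTo_squareDir_of_mem_Ioc hmod
  set γ := toIocMod hp (-(Real.pi / 4)) β
  set n := toIocDiv hp (-(Real.pi / 4)) β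
  have hβ : β = γ + n * (Real.pi / 2) := by
    have := toIocMod_add_toIocDiv_zsmul hp (-(Real.pi / 4)) β
    rw [zsmul_eq_mul] at this
    exact this.symm
  -- A negative number of quarter turns is replaced by a nonnegative one, up to full turns.
  obtain ⟨m, k, hmk⟩ : ∃ m k : ℕ, n = (m : ℤ) - 4 * k :=
    ⟨(n + 4 * n.natAbs).toNat, n.natAbs, by omega⟩
  have h1 := hper γ hb m
  have h2 : β = γ + m * (Real.pi / 2) - k * (2 * Real.pi) := by
    rw [hβ, hmk]
    push_cast
    ring
  have hp' : ∀ x, squareDir (x - k * (2 * Real.pi)) = squareDir x := fun x =>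
    Function.Periodic.sub_nat_mul_eq (f := squareDir) squareDir_add_two_pi k
  intro r hr ρ hρ
  have hmap : Tendsto (fun t => t + k * (2 * Real.pi)) (𝓝[<] β)
      (𝓝[<] (γ + m * (Real.pi / 2))) := by
    refine tendsto_nhdsWithin_iff.2 ⟨?_, ?_⟩
    · have : ContinuousAt (fun t : ℝ => t + k * (2 * Real.pi)) β := by fun_prop
      have h3 := this.tendsto.mono_left (nhdsWithin_le_nhds (s := Iio β))
      convert h3 using 2
      rw [h2]
      ring
    · filter_upwards [self_mem_nhdsWithin] with t ht
      simp only [mem_Iio] at ht ⊢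
      linarith
  filter_upwards [hmap.eventually (h1 r hr ρ hρ)] with t ht s hs R hR
  have h4 := ht (s + k * (2 * Real.pi)) ⟨by linarith [hs.1], by linarith [hs.2]⟩ R hR
  rw [← hp' (s + _), ← hp' (t + _)] at h4
  simpa using h4

theorem coversUpTo_squareDir_neg (β : ℝ) :
    CoversUpTo (fun t => squareDir (-t)) β := by
  intro r hr ρ hρ
  filter_upwards [coversUpTo_squareDir β r hr ρ hρ] with t ht s hs R hR
  have h := ht s hs R hR
  simp only [squareDir_neg]
  rw [Prod.norm_def] at h ⊢
  simp only [Prod.fst_sub, Prod.snd_sub, Prod.smul_fst, Prod.smul_snd, smul_eq_mul,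
    Real.norm_eq_abs, max_le_iff] at h ⊢
  refine ⟨h.1, ?_⟩
  rw [← abs_neg]
  convert h.2 using 2
  ring

/-! ### Crosscuts -/

/-- The identification of `ℝ × ℝ` with `ℂ`. -/
noncomputable def toComplex (z : ℝ × ℝ) : ℂ := z.1 + z.2 * Complex.I

theorem toComplex_eq (z : ℝ × ℝ) : toComplex z = Complex.equivRealProdCLM.symm z := by
  exact (Complex.equivRealProdCLM_symm_apply z).symm

theorem continuous_toComplex : Continuous toComplex := by
  unfold toComplex
  fun_prop

theorem toComplex_injective : Function.Injective toComplex := fun a b h => by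
  rw [toComplex_eq, toComplex_eq] at h
  exact Complex.equivRealProdCLM.symm.injective h

theorem toComplex_add (a b : ℝ × ℝ) : toComplex (a + b) = toComplex a + toComplex b := by
  simp only [toComplex_eq, map_add]

theorem toComplex_smul (x : ℝ) (a : ℝ × ℝ) : toComplex (x • a) = x * toComplex a := by
  simp only [toComplex_eq, map_smul, Complex.real_smul]

theorem toComplex_sub_div_mem_slitPlane {a b z : ℝ × ℝ} (hz : z ∉ segment ℝ a b) :
    (toComplex z - toComplex a) / (toComplex z - toComplex b) ∈ Complex.slitPlane := by
  rw [Complex.mem_slitPlane_iff_not_le_zero]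
  intro hle
  have hzb : z ≠ b := fun h => hz (h ▸ right_mem_segment ℝ a b)
  have hd : toComplex z - toComplex b ≠ 0 := sub_ne_zero.2 fun h => hzb (toComplex_injective h)
  obtain ⟨k, hk, hk'⟩ : ∃ k : ℝ, 0 ≤ k ∧
      (toComplex z - toComplex a) / (toComplex z - toComplex b) = -(k : ℂ) := by
    set w := (toComplex z - toComplex a) / (toComplex z - toComplex b)
    rw [Complex.le_def] at hle
    refine ⟨-w.re, by simpa using hle.1, ?_⟩
    apply Complex.ext <;> simp [hle.2]
  rw [div_eq_iff hd] at hk'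
  apply hz
  refine ⟨(1 + k)⁻¹, k * (1 + k)⁻¹, by positivity, by positivity, by field_simp, ?_⟩
  apply toComplex_injective
  have h1 : ((1 : ℂ) + k) ≠ 0 := by
    have : (1 : ℝ) + k ≠ 0 := by positivity
    exact_mod_cast this
  rw [toComplex_add, toComplex_smul, toComplex_smul]
  push_cast
  field_simp
  linear_combination -hk'

/-- A branch of the logarithm of `(z - a) / (z - b)`, continuous off the segment `[a, b]`. -/
noncomputable def segLog (a b z : ℝ × ℝ) : ℂ :=
  Complex.log ((toComplex z - toComplex a) / (toComplex z - toComplex b))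

theorem continuousAt_segLog {a b z : ℝ × ℝ} (hz : z ∉ segment ℝ a b) :
    ContinuousAt (segLog a b) z := by
  have hzb : z ≠ b := fun h => hz (h ▸ right_mem_segment ℝ a b)
  have hd : toComplex z - toComplex b ≠ 0 := sub_ne_zero.2 fun h => hzb (toComplex_injective h)
  refine ContinuousAt.clog ?_ (toComplex_sub_div_mem_slitPlane hz)
  exact (continuous_toComplex.continuousAt.sub continuousAt_const).div
    (continuous_toComplex.continuousAt.sub continuousAt_const) hd

theorem exp_segLog {a b z : ℝ × ℝ} (hz : z ∉ segment ℝ a b) :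
    Complex.exp (segLog a b z) =
      (toComplex z - toComplex a) / (toComplex z - toComplex b) :=
  Complex.exp_log (Complex.slitPlane_ne_zero (toComplex_sub_div_mem_slitPlane hz))

theorem eq_of_mem_segment_of_le_dist {b q z : ℝ × ℝ} {R : ℝ} (hR : 0 < R) (hb : dist b q ≤ R)
    (hz : z ∈ segment ℝ b q) (hzR : R ≤ dist z q) : z = b := by
  obtain ⟨x, y, hx, hy, hxy, rfl⟩ := hz
  have e : x • b + y • q - q = x • (b - q) := by
    rw [show y = 1 - x by linarith]
    module
  rw [dist_eq_norm, e, norm_smul, ← dist_eq_norm, Real.norm_eq_abs, abs_of_nonneg hx] at hzR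
  have hx1 : x = 1 := by
    refine le_antisymm (by linarith) ?_
    by_contra! h
    have : x * dist b q ≤ x * R := mul_le_mul_of_nonneg_left hb hx
    nlinarith
  have hy0 : y = 0 := by linarith
  simp [hx1, hy0]

theorem eq_of_mem_segment_touching {c v z : ℝ × ℝ} (hv : ‖v‖ = 1) {r a : ℝ} (ha : 0 < a)
    (hz : z ∈ segment ℝ (c + a • v) c) (hzr : dist z c = r) : z = c + r • v := by
  obtain ⟨x, y, hx, hy, hxy, rfl⟩ := hz
  have e : x • (c + a • v) + y • c = c + (x * a) • v := by
    rw [show y = 1 - x by linarith]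
    module
  rw [e] at hzr ⊢
  rw [dist_comm, dist_touching_center c v hv (by positivity)] at hzr
  rw [hzr]

/-- The branch of the logarithm with a cut along the segment joining the centres of two touching
squares has one-sided limits along the boundary at the contact point, and they differ by `2πi`. -/
theorem tendsto_segLog_touching (c : ℝ × ℝ) {r R : ℝ} (hr : 0 < r) (hR : 0 < R) (t : ℝ) :
    ∃ L : ℂ,
      Tendsto (fun s => segLog (c + (r + R) • squareDir t) c (c + r • squareDir s)) (𝓝[<] t)
        (𝓝 (L - Real.pi * Complex.I)) ∧
      Tendsto (fun s => segLog (c + (r + R) • squareDir t) c (c + r • squareDir s)) (𝓝[>] t)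
        (𝓝 (L + Real.pi * Complex.I)) := by
  set N : ℝ → ℝ := fun s => ‖(Real.cos s, Real.sin s)‖
  have hN : ∀ s, 0 < N s := norm_cos_sin_pos
  have hNc : Continuous N := (Real.continuous_cos.prodMk Real.continuous_sin).norm
  set K : ℝ → ℝ := fun s => (r + R) / r * (N s / N t)
  have hK : ∀ s, 0 < K s := fun s => by have := hN s; have := hN t; positivity
  set w : ℝ → ℂ := fun s => 1 - K s * Complex.exp (((t - s : ℝ) : ℂ) * Complex.I)
  have hw : Continuous w := by
    have : Continuous K := continuous_const.mul (hNc.div_const _)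
    fun_prop
  have hdir : ∀ s, toComplex (squareDir s) = ((N s)⁻¹ : ℝ) * Complex.exp (s * Complex.I) :=
    squareDir_complex
  have hseg : ∀ s, segLog (c + (r + R) • squareDir t) c (c + r • squareDir s) =
      Complex.log (w s) := by
    intro s
    rw [segLog]
    congr 1
    rw [toComplex_add, toComplex_add, toComplex_smul, toComplex_smul, hdir, hdir]
    have e : Complex.exp (((t - s : ℝ) : ℂ) * Complex.I) =
        Complex.exp (t * Complex.I) / Complex.exp (s * Complex.I) := by
      rw [← Complex.exp_sub]
      congr 1
      push_cast
      ring
    have h1 : (r : ℂ) ≠ 0 := by exact_mod_cast hr.ne'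
    have h2 : (N s : ℂ) ≠ 0 := by exact_mod_cast (hN s).ne'
    have h3 : (N t : ℂ) ≠ 0 := by exact_mod_cast (hN t).ne'
    have h4 := Complex.exp_ne_zero (s * Complex.I)
    simp only [w, K, e]
    push_cast
    field_simp
    ring
  have hwim : ∀ s, (w s).im = K s * Real.sin (s - t) := by
    intro s
    simp only [w, Complex.sub_im, Complex.one_im, Complex.im_ofReal_mul,
      Complex.exp_ofReal_mul_I_im]
    rw [← neg_sub s t, Real.sin_neg]
    ring
  have hwt : w t = ((-(R / r) : ℝ) : ℂ) := by
    have h1 : (r : ℂ) ≠ 0 := by exact_mod_cast hr.ne'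
    have h3 : (N t : ℂ) ≠ 0 := by exact_mod_cast (hN t).ne'
    simp only [w, K, sub_self]
    push_cast
    simp only [zero_mul, Complex.exp_zero]
    field_simp
    ring
  have hre : (w t).re < 0 := by
    rw [hwt, Complex.ofReal_re]
    have : 0 < R / r := by positivity
    linarith
  have him : (w t).im = 0 := by rw [hwt, Complex.ofReal_im]
  have hpi := Real.pi_pos
  simp only [hseg]
  refine ⟨Real.log ‖w t‖, ?_, ?_⟩
  · refine (Complex.tendsto_log_nhdsWithin_im_neg_of_re_neg_of_im_zero hre him).comp ?_
    refine tendsto_nhdsWithin_iff.2 ⟨hw.continuousAt.tendsto.mono_left nhdsWithin_le_nhds, ?_⟩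
    filter_upwards [Ioo_mem_nhdsLT (show t - Real.pi < t by linarith)] with s hs
    rw [hwim]
    exact mul_neg_of_pos_of_neg (hK s)
      (Real.sin_neg_of_neg_of_neg_pi_lt (by linarith [hs.2]) (by linarith [hs.1]))
  · refine (Complex.tendsto_log_nhdsWithin_im_nonneg_of_re_neg_of_im_zero hre him).comp ?_
    refine tendsto_nhdsWithin_iff.2 ⟨hw.continuousAt.tendsto.mono_left nhdsWithin_le_nhds, ?_⟩
    filter_upwards [Ioo_mem_nhdsGT (show t < t + Real.pi by linarith)] with s hs
    rw [hwim]
    exact mul_nonneg (hK s).le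
      (Real.sin_nonneg_of_nonneg_of_le_pi (by linarith [hs.1]) (by linarith [hs.2]))

/-- The crosscut which runs from a point `e` outside `Ω` on the boundary of a square through the
contact point at angle `t` to a point `b` outside `Ω` on the closure of a touching square separates
the boundary points of the first square on the two sides of `t`: the function
`(z - b) / (z - e)` has a continuous logarithm on `Ω`, and it has one off the crosscut, which
jumps by `2πi` across it. -/
theorem IsSimplyConnected.false_of_joined_across_crosscut {Ω C : Set (ℝ × ℝ)}
    (hsc : IsSimplyConnected Ω) (hΩ : IsOpen Ω) {c e b : ℝ × ℝ} {r R t s₁ s₂ : ℝ} (hr : 0 < r)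
    (hR : 0 < R) (he : e ∉ Ω) (hec : dist e c = r) (hb : b ∉ Ω)
    (hbq : b ∈ closedBall (c + (r + R) • squareDir t) R) (h1 : s₁ < t) (h2 : t < s₂)
    (harc : ∀ s ∈ Icc s₁ s₂, c + r • squareDir s ∈ Ω) (hlen : s₂ - s₁ < 2 * Real.pi)
    (hC : IsPreconnected C) (hCΩ : C ⊆ Ω) (hCc : Disjoint C (ball c r))
    (hCq : Disjoint C (closedBall (c + (r + R) • squareDir t) R))
    (hs₁ : c + r • squareDir s₁ ∈ C) (hs₂ : c + r • squareDir s₂ ∈ C) : False := by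
  set θ : ℝ → ℝ × ℝ := fun s => c + r • squareDir s
  have hθ : Continuous θ := continuous_const.add (continuous_squareDir.const_smul r)
  set q := c + (r + R) • squareDir t
  have hcq : dist c q = r + R := dist_touching_center c _ (norm_squareDir t) (by linarith)
  have hθc : ∀ s, dist (θ s) c = r := fun s => by
    rw [dist_comm]; exact dist_touching_center c _ (norm_squareDir s) hr.le
  have hsegce : ∀ z ∈ Ω, r ≤ dist z c → z ∉ segment ℝ c e := fun z hz hzc hzs => by
    rw [segment_symm] at hzs
    exact he (eq_of_mem_segment_of_le_dist hr hec.le hzs hzc ▸ hz)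
  have hsegbq : ∀ z ∈ Ω, R ≤ dist z q → z ∉ segment ℝ b q := fun z hz hzq hzs =>
    hb (eq_of_mem_segment_of_le_dist hR (mem_closedBall.1 hbq) hzs hzq ▸ hz)
  have hθq : ∀ s, R ≤ dist (θ s) q := fun s => by
    have := dist_triangle c (θ s) q
    rw [dist_comm c (θ s), hθc, hcq] at this
    linarith
  have hθseg : ∀ s ∈ Icc s₁ s₂, s ≠ t → θ s ∉ segment ℝ q c := fun s hs hst hzs => by
    have h := eq_of_mem_segment_touching (norm_squareDir t) (by linarith) hzs (hθc s)
    have h' : squareDir s = squareDir t := by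
      have := add_left_cancel h
      exact smul_right_injective _ hr.ne' this
    exact hst (squareDir_injective_of_abs_sub_lt h' (by
      rw [abs_lt]; constructor <;> linarith [hs.1, hs.2]))
  -- The set on which the two logarithms are compared: `C` with the two arcs of the boundary.
  set X := C ∪ θ '' Ico s₁ t ∪ θ '' Ioc t s₂
  have hX : IsPreconnected X := by
    refine IsPreconnected.union (θ s₂) (Or.inl hs₂) ⟨s₂, ⟨h2, le_rfl⟩, rfl⟩ ?_
      (isPreconnected_Ioc.image _ hθ.continuousOn)
    exact IsPreconnected.union (θ s₁) hs₁ ⟨s₁, ⟨le_rfl, h1⟩, rfl⟩ hC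
      (isPreconnected_Ico.image _ hθ.continuousOn)
  have hXΩ : X ⊆ Ω := by
    rintro z ((hz | ⟨s, hs, rfl⟩) | ⟨s, hs, rfl⟩)
    · exact hCΩ hz
    · exact harc s ⟨hs.1, hs.2.le.trans h2.le⟩
    · exact harc s ⟨h1.le.trans hs.1.le, hs.2⟩
  have hXc : ∀ z ∈ X, r ≤ dist z c := by
    rintro z ((hz | ⟨s, hs, rfl⟩) | ⟨s, hs, rfl⟩)
    · simpa using disjoint_left.1 hCc hz
    · exact (hθc s).ge
    · exact (hθc s).ge
  have hXq : ∀ z ∈ X, R ≤ dist z q := by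
    rintro z ((hz | ⟨s, hs, rfl⟩) | ⟨s, hs, rfl⟩)
    · have : R < dist z q := by simpa using disjoint_left.1 hCq hz
      exact this.le
    · exact hθq s
    · exact hθq s
  have hXseg : ∀ z ∈ X, z ∉ segment ℝ q c := by
    rintro z ((hz | ⟨s, hs, rfl⟩) | ⟨s, hs, rfl⟩)
    · intro hzs
      have e1 := dist_add_dist_of_mem_segment hzs
      have e2 : R < dist z q := by simpa using disjoint_left.1 hCq hz
      have e3 : r ≤ dist z c := by simpa using disjoint_left.1 hCc hz
      rw [dist_comm q z, dist_comm q c, hcq] at e1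
      linarith
    · exact hθseg s ⟨hs.1, hs.2.le.trans h2.le⟩ hs.2.ne
    · exact hθseg s ⟨h1.le.trans hs.1.le, hs.2⟩ hs.1.ne'
  have hne : ∀ z ∈ Ω, ∀ a ∉ Ω, toComplex z - toComplex a ≠ 0 := fun z hz a ha =>
    sub_ne_zero.2 fun h => ha (toComplex_injective h ▸ hz)
  obtain ⟨f, hf, hfexp⟩ := Complex.exists_continuousOn_eqOn_exp_comp hsc hΩ
    (g := fun z => (toComplex z - toComplex b) / (toComplex z - toComplex e))
    (ContinuousOn.div (continuous_toComplex.continuousOn.sub continuousOn_const)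
      (continuous_toComplex.continuousOn.sub continuousOn_const) fun z hz => hne z hz e he)
    (by
      rintro ⟨z, hz, h0⟩
      exact div_ne_zero (hne z hz b hb) (hne z hz e he) h0)
  set g : ℝ × ℝ → ℂ := fun z => segLog b q z + segLog q c z + segLog c e z
  have hg : ContinuousOn g X := fun z hz =>
    (((continuousAt_segLog (hsegbq z (hXΩ hz) (hXq z hz))).add
      (continuousAt_segLog (hXseg z hz))).add
      (continuousAt_segLog (hsegce z (hXΩ hz) (hXc z hz)))).continuousWithinAt
  have hfg : ∀ z ∈ X, Complex.exp (f z) = Complex.exp (g z) := by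
    intro z hz
    have e1 := hsegbq z (hXΩ hz) (hXq z hz)
    have e2 := hXseg z hz
    have e3 := hsegce z (hXΩ hz) (hXc z hz)
    have n1 : toComplex z - toComplex q ≠ 0 :=
      sub_ne_zero.2 fun h => e2 (toComplex_injective h ▸ left_mem_segment ℝ q c)
    have n2 : toComplex z - toComplex c ≠ 0 :=
      sub_ne_zero.2 fun h => e2 (toComplex_injective h ▸ right_mem_segment ℝ q c)
    have n3 := hne z (hXΩ hz) e he
    have := hfexp (hXΩ hz)
    simp only [Function.comp_apply] at this
    rw [this, Complex.exp_add, Complex.exp_add, exp_segLog e1, exp_segLog e2, exp_segLog e3]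
    field_simp
  have hconst : ∀ z ∈ X, f z - g z = f (θ s₁) - g (θ s₁) := fun z hz =>
    hX.sub_eq_sub_of_exp_eq (hf.mono hXΩ) hg hfg hz (Or.inl (Or.inl hs₁))
  set k := f (θ s₁) - g (θ s₁)
  have htmem : θ t ∈ Ω := harc t ⟨h1.le, h2.le⟩
  set G : ℝ → ℂ := fun s => f (θ s) - segLog b q (θ s) - segLog c e (θ s) - k
  have hG : ContinuousAt G t := by
    have c1 : ContinuousAt (fun s => f (θ s)) t :=
      (hf.continuousAt (hΩ.mem_nhds htmem)).comp (f := θ) hθ.continuousAt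
    have c2 : ContinuousAt (fun s => segLog b q (θ s)) t :=
      (continuousAt_segLog (hsegbq _ htmem (hθq t))).comp (f := θ) hθ.continuousAt
    have c3 : ContinuousAt (fun s => segLog c e (θ s)) t :=
      (continuousAt_segLog (hsegce _ htmem (hθc t).ge)).comp (f := θ) hθ.continuousAt
    exact ((c1.sub c2).sub c3).sub continuousAt_const
  have hGeq : ∀ s, θ s ∈ X → G s = segLog q c (θ s) := fun s hs => by
    have := hconst _ hs
    simp only [G, g] at this ⊢
    linear_combination this
  obtain ⟨L, hL1, hL2⟩ := tendsto_segLog_touching c hr hR t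
  have lim1 : Tendsto G (𝓝[<] t) (𝓝 (L - Real.pi * Complex.I)) := by
    refine hL1.congr' ?_
    filter_upwards [Ico_mem_nhdsLT h1] with s hs
    exact (hGeq s (Or.inl (Or.inr ⟨s, hs, rfl⟩))).symm
  have lim2 : Tendsto G (𝓝[>] t) (𝓝 (L + Real.pi * Complex.I)) := by
    refine hL2.congr' ?_
    filter_upwards [Ioc_mem_nhdsGT h2] with s hs
    exact (hGeq s (Or.inr ⟨s, hs, rfl⟩)).symm
  have u1 := tendsto_nhds_unique lim1 (hG.tendsto.mono_left nhdsWithin_le_nhds)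
  have u2 := tendsto_nhds_unique lim2 (hG.tendsto.mono_left nhdsWithin_le_nhds)
  have h3 : (2 * Real.pi * Complex.I : ℂ) = 0 := by linear_combination u2 - u1
  simp [Real.pi_ne_zero] at h3

/-! ### Touching squares which separate -/

/-- The point `y` can be connected within `Ω` to a point of `T` without entering the open square of
centre `c` and radius `r` and without meeting `Q`. -/
def Reaches (Ω : Set (ℝ × ℝ)) (c : ℝ × ℝ) (r : ℝ) (y : ℝ × ℝ) (T Q : Set (ℝ × ℝ)) : Prop :=
  ∃ C, IsCompact C ∧ IsPreconnected C ∧ C ⊆ Ω ∧ Disjoint C (ball c r) ∧ Disjoint C Q ∧ y ∈ C ∧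
    (C ∩ T).Nonempty

/-- Touching squares whose point of contact moves towards an end `β` of a boundary arc cannot all
leave `y` connected to the part of the arc ahead of them: a fixed path from `y` to the arc has
to be met by all squares far enough along the arc, so these are not small, and a
square which is not small covers all of the arc that remains. -/
theorem not_forall_reaches_ahead {Ω : Set (ℝ × ℝ)} {c y : ℝ × ℝ} {r α β : ℝ} (hr : 0 < r)
    {u : ℝ → ℝ × ℝ} (hu : Continuous u) (hu1 : ∀ t, ‖u t‖ = 1) (hcov : CoversUpTo u β)
    (hαβ : α < β) (hβ : c + r • u β ∉ Ω) (Rad : ℝ → ℝ) (hRad : ∀ t ∈ Ioo α β, 0 < Rad t)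
    (hahead : ∀ t ∈ Ioo α β, Reaches Ω c r y ((fun s => c + r • u s) '' Ioo t β)
      (closedBall (c + (r + Rad t) • u t) (Rad t)))
    (hbehind : ∀ t ∈ Ioo α β, ¬ Reaches Ω c r y ((fun s => c + r • u s) '' Ioo α t)
      (closedBall (c + (r + Rad t) • u t) (Rad t))) : False := by
  set θ : ℝ → ℝ × ℝ := fun s => c + r • u s
  have hθ : Continuous θ := continuous_const.add (hu.const_smul r)
  obtain ⟨t₁, ht₁⟩ := nonempty_Ioo.2 hαβ
  obtain ⟨C, hC, hCp, hCΩ, hCc, -, hyC, _, hz, ⟨s₁, hs₁, rfl⟩⟩ := hahead t₁ ht₁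
  have hs₁' : α < s₁ := ht₁.1.trans hs₁.1
  obtain ⟨δ, hδ, hδC⟩ := Metric.isOpen_iff.1 hC.isClosed.isOpen_compl (θ β) fun h => hβ (hCΩ h)
  have ev1 : ∀ᶠ t in 𝓝[<] β, dist (θ t) (θ β) < δ / 2 := by
    have : ContinuousAt (fun t => dist (θ t) (θ β)) β := by fun_prop
    exact (this.eventually (gt_mem_nhds (by simpa using hδ))).filter_mono nhdsWithin_le_nhds
  obtain ⟨t, ⟨htd, htI⟩, htc⟩ :=
    ((ev1.and (Ioo_mem_nhdsLT hs₁.2)).and (hcov r hr (δ / 4) (by positivity))).exists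
  have htαβ : t ∈ Ioo α β := ⟨hs₁'.trans htI.1, htI.2⟩
  have hpos := hRad t htαβ
  have hmeet : ¬ Disjoint C (closedBall (c + (r + Rad t) • u t) (Rad t)) := fun hd =>
    hbehind t htαβ ⟨C, hC, hCp, hCΩ, hCc, hd, hyC, _, hz, ⟨s₁, ⟨hs₁', htI.1⟩, rfl⟩⟩
  obtain ⟨p, hpC, hp⟩ := not_disjoint_iff.1 hmeet
  have hδp : δ ≤ dist p (θ β) := by
    by_contra! h
    exact hδC h hpC
  have hlarge : δ / 4 ≤ Rad t := by
    have e1 := dist_triangle4 p (c + (r + Rad t) • u t) (θ t) (θ β)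
    have e2 : dist (c + (r + Rad t) • u t) (θ t) = Rad t := by
      rw [dist_touching_centers c _ (hu1 t), abs_of_nonneg (by linarith)]
      ring
    rw [mem_closedBall] at hp
    linarith
  obtain ⟨C', -, -, -, -, hd, -, _, hz', ⟨s, hs, rfl⟩⟩ := hahead t htαβ
  refine disjoint_left.1 hd hz' ?_
  rw [mem_closedBall, dist_add_left, dist_eq_norm]
  exact htc s ⟨hs.1.le, hs.2.le⟩ _ hlarge

/-- Given a square whose closure is not contained in `Ω`, and a point `y` of `Ω` outside of its
closure, there is a touching square which either contains `y` in its closure or separates `y` from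
the given square.

The candidates are the maximal touching squares, parametrised by the angle of their point of
contact, which varies in an arc of the boundary. If none of them is as required, then the
arc is the disjoint union of two open sets, according to the side on which `y` can reach the arc
past the touching square; and neither of the two can be the whole arc. -/
theorem exists_touching_square {Ω : Set (ℝ × ℝ)} (hΩ : IsOpen Ω) (hconn : IsConnected Ω)
    (hsc : IsSimplyConnected Ω) (hbdd : Bornology.IsBounded Ω) {c : ℝ × ℝ} {r : ℝ} (hr : 0 < r)
    (hsub : ball c r ⊆ Ω) (hnot : ¬ closedBall c r ⊆ Ω) {y : ℝ × ℝ} (hy : y ∈ Ω)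
    (hyc : y ∉ closedBall c r) :
    ∃ c' r', 0 < r' ∧ ball c' r' ⊆ Ω ∧ ¬ closedBall c' r' ⊆ Ω ∧ dist c c' = r + r' ∧
      (closedBall c r ∩ closedBall c' r' ∩ Ω).Nonempty ∧
      (y ∉ closedBall c' r' → y ∉ connectedComponentIn (Ω \ closedBall c' r') c) := by
  by_contra H
  have hpi := Real.pi_pos
  set θ : ℝ → ℝ × ℝ := fun s => c + r • squareDir s
  have hθ : Continuous θ := continuous_const.add (continuous_squareDir.const_smul r)
  have hθc : ∀ s, dist (θ s) c = r := fun s => by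
    rw [dist_comm]; exact dist_touching_center c _ (norm_squareDir s) hr.le
  have hθper : ∀ s, θ (s + 2 * Real.pi) = θ s := fun s => by
    simp only [θ, squareDir_add_two_pi]
  have hθsurj : ∀ z, dist z c = r → ∀ a, ∃ s ∈ Ico a (a + 2 * Real.pi), θ s = z := by
    intro z hz a
    have hv : ‖r⁻¹ • (z - c)‖ = 1 := by
      rw [norm_smul, ← dist_eq_norm, hz, norm_inv, Real.norm_eq_abs, abs_of_pos hr,
        inv_mul_cancel₀ hr.ne']
    obtain ⟨s, hs, hsv⟩ := exists_squareDir_eq hv a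
    refine ⟨s, hs, ?_⟩
    simp only [θ, hsv, smul_smul, mul_inv_cancel₀ hr.ne', one_smul, add_sub_cancel]
  have hθinj : ∀ a b, θ a = θ b → |a - b| < 2 * Real.pi → a = b := fun a b h hab =>
    squareDir_injective_of_abs_sub_lt
      (smul_right_injective _ hr.ne' (add_left_cancel h)) hab
  have hint : interior (closedBall c r) = ball c r := interior_closedBall c hr.ne'
  have hcΩ : c ∈ Ω := hsub (mem_ball_self hr)
  have hcK : c ∈ closedBall c r := mem_closedBall_self hr.le
  have hsphere : ∀ z ∈ closedBall c r, z ∉ ball c r → dist z c = r := fun z h1 h2 =>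
    le_antisymm h1 (not_lt.1 h2)
  -- A boundary point outside `Ω`, and a boundary point which can be reached from `y`.
  obtain ⟨e, heK, heΩ⟩ := not_subset.1 hnot
  have hec : dist e c = r := hsphere e heK fun h => heΩ (hsub h)
  obtain ⟨C₀, z₀, -, hC₀p, hC₀Ω, hyC₀, hz₀C, hz₀K, -, hC₀i⟩ :=
    exists_isCompact_isPreconnected_first_hit isClosed_closedBall
      ((hΩ.isConnected_iff_isPathConnected.1 hconn).joinedIn y hy c hcΩ) hyc hcK
  rw [hint] at hC₀i
  obtain ⟨t₀, -, ht₀⟩ := hθsurj z₀ (hsphere z₀ hz₀K (hC₀i z₀ hz₀C)) 0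
  have hz₀Ω : z₀ ∈ Ω := hC₀Ω hz₀C
  -- The maximal arc in `Ω` around this point has the angles between `α` and `β`.
  set E := {t | θ t ∉ Ω}
  have hE : IsClosed E := (hΩ.isClosed_compl).preimage hθ
  have ht₀E : t₀ ∉ E := by
    simp only [E, mem_ofPred_eq, not_not, ht₀, hz₀Ω]
  obtain ⟨a₁, ha₁, hea₁⟩ := hθsurj e hec (t₀ - 2 * Real.pi)
  obtain ⟨b₁, hb₁, heb₁⟩ := hθsurj e hec t₀
  have ha₁E : a₁ ∈ E ∩ Iic t₀ :=
    ⟨by simpa only [E, mem_ofPred_eq, hea₁] using heΩ, by simp only [mem_Iic]; linarith [ha₁.2]⟩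
  have hb₁E : b₁ ∈ E ∩ Ici t₀ := ⟨by simpa only [E, mem_ofPred_eq, heb₁] using heΩ, hb₁.1⟩
  have hαm : sSup (E ∩ Iic t₀) ∈ E ∩ Iic t₀ :=
    (hE.inter isClosed_Iic).csSup_mem ⟨a₁, ha₁E⟩ ⟨t₀, fun x hx => hx.2⟩
  have hβm : sInf (E ∩ Ici t₀) ∈ E ∩ Ici t₀ :=
    (hE.inter isClosed_Ici).csInf_mem ⟨b₁, hb₁E⟩ ⟨t₀, fun x hx => hx.2⟩
  have hαub : ∀ x ∈ E, x ≤ t₀ → x ≤ sSup (E ∩ Iic t₀) := fun x h1 h2 =>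
    le_csSup ⟨t₀, fun x hx => hx.2⟩ ⟨h1, h2⟩
  have hβlb : ∀ x ∈ E, t₀ ≤ x → sInf (E ∩ Ici t₀) ≤ x := fun x h1 h2 =>
    csInf_le ⟨t₀, fun x hx => hx.2⟩ ⟨h1, h2⟩
  set α := sSup (E ∩ Iic t₀)
  set β := sInf (E ∩ Ici t₀)
  have hαt : α < t₀ := lt_of_le_of_ne hαm.2 fun h => ht₀E (h ▸ hαm.1)
  have htβ : t₀ < β := lt_of_le_of_ne hβm.2 fun h => ht₀E (h ▸ hβm.1)
  have hαβ : α < β := hαt.trans htβ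
  have hlen : β ≤ α + 2 * Real.pi := by
    refine hβlb _ ?_ ?_
    · simpa only [E, mem_ofPred_eq, hθper] using hαm.1
    · linarith [hαub a₁ ha₁E.1 ha₁E.2, ha₁.1]
  have harc : ∀ t ∈ Ioo α β, θ t ∈ Ω := by
    intro t ht
    by_contra h
    rcases le_total t t₀ with h' | h'
    · exact absurd (hαub t h h') (not_le.2 ht.1)
    · exact absurd (hβlb t h h') (not_le.2 ht.2)
  -- The maximal touching squares.
  have hex : ∀ t, ∃ R, t ∈ Ioo α β → 0 < R ∧ ball (c + (r + R) • squareDir t) R ⊆ Ω ∧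
      ¬ closedBall (c + (r + R) • squareDir t) R ⊆ Ω ∧
      ∀ ρ, ball (c + (r + ρ) • squareDir t) ρ ⊆ Ω → ρ ≤ R := by
    intro t
    by_cases ht : t ∈ Ioo α β
    · obtain ⟨R, hR⟩ := exists_maximal_touching_radius hΩ hbdd (norm_squareDir t) hr (harc t ht)
      exact ⟨R, fun _ => hR⟩
    · exact ⟨0, fun h => absurd h ht⟩
  choose Rad hRad using hex
  set q : ℝ → ℝ × ℝ := fun t => c + (r + Rad t) • squareDir t
  have hθq : ∀ t ∈ Ioo α β, θ t ∈ closedBall (q t) (Rad t) := by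
    intro t ht
    rw [mem_closedBall, dist_touching_centers c _ (norm_squareDir t),
      abs_of_nonpos (by linarith [(hRad t ht).1])]
    linarith
  have hnosep : ∀ t ∈ Ioo α β, y ∈ connectedComponentIn (Ω \ closedBall (q t) (Rad t)) c := by
    intro t ht
    obtain ⟨h1, h2, h3, -⟩ := hRad t ht
    by_contra h
    exact H ⟨q t, Rad t, h1, h2, h3, dist_touching_center c _ (norm_squareDir t) (by linarith),
      ⟨θ t, ⟨(hθc t).le, hθq t ht⟩, harc t ht⟩, fun _ => h⟩
  have hcover : ∀ t ∈ Ioo α β,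
      Reaches Ω c r y (θ '' Ioo t β) (closedBall (q t) (Rad t)) ∨
        Reaches Ω c r y (θ '' Ioo α t) (closedBall (q t) (Rad t)) := by
    intro t ht
    set F := Ω \ closedBall (q t) (Rad t)
    have hF : IsOpen F := hΩ.sdiff isClosed_closedBall
    have hyV := hnosep t ht
    have hcF : c ∈ F := connectedComponentIn_nonempty_iff.1 ⟨y, hyV⟩
    have hVpc : IsPathConnected (connectedComponentIn F c) :=
      (hF.connectedComponentIn.isConnected_iff_isPathConnected).1
        (isConnected_connectedComponentIn_iff.2 hcF)
    obtain ⟨C, z, hCc, hCp, hCV, hyC, hzC, hzK, -, hCi⟩ :=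
      exists_isCompact_isPreconnected_first_hit isClosed_closedBall
        (hVpc.joinedIn y hyV c (mem_connectedComponentIn hcF)) hyc hcK
    rw [hint] at hCi
    have hCF : C ⊆ F := hCV.trans (connectedComponentIn_subset F c)
    have hCΩ : C ⊆ Ω := hCF.trans sdiff_subset
    obtain ⟨s, hs, rfl⟩ := hθsurj z (hsphere z hzK (hCi z hzC)) α
    have hsE : s ∉ E := fun h => h (hCΩ hzC)
    have hsα : α < s := lt_of_le_of_ne hs.1 fun h => hsE (h ▸ hαm.1)
    have hd : Disjoint C (ball c r) := disjoint_left.2 hCi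
    have hdQ : Disjoint C (closedBall (q t) (Rad t)) := disjoint_left.2 fun w hw => (hCF hw).2
    by_cases hsβ : s < β
    · rcases lt_trichotomy s t with h | h | h
      · exact Or.inr ⟨C, hCc, hCp, hCΩ, hd, hdQ, hyC, θ s, hzC, s, ⟨hsα, h⟩, rfl⟩
      · exact absurd (hθq t ht) (h ▸ (hCF hzC).2)
      · exact Or.inl ⟨C, hCc, hCp, hCΩ, hd, hdQ, hyC, θ s, hzC, s, ⟨h, hsβ⟩, rfl⟩
    · -- Otherwise `y` reaches two different arcs of the boundary in `Ω`.
      exfalso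
      push Not at hsβ
      refine hsc.false_of_separated_inter hΩ (A := (ball c r)ᶜ) (B := closedBall c r)
        (K₁ := θ '' Icc α β) (K₂ := θ '' Icc β (α + 2 * Real.pi)) (C := C₀ ∪ C)
        (D := closedBall c r ∩ Ω) (p := z₀) (q := θ s)
        isOpen_ball.isClosed_compl isClosed_closedBall ?_ (isCompact_Icc.image hθ).isClosed
        (isCompact_Icc.image hθ).isClosed ?_ ?_ (hC₀p.union y hyC₀ hyC hCp) ?_ ?_ ?_
        ⟨t₀, ⟨hαt.le, htβ.le⟩, ht₀⟩ ⟨s, ⟨hsβ, hs.2.le⟩, rfl⟩ (Or.inl hz₀C) (Or.inr hzC)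
        ⟨hz₀K, hz₀Ω⟩ ⟨hzK, hCΩ hzC⟩
      · intro w _
        by_cases hw : w ∈ ball c r
        · exact Or.inr (ball_subset_closedBall hw)
        · exact Or.inl hw
      · rintro w ⟨-, hw1, hw2⟩
        obtain ⟨s', hs', rfl⟩ := hθsurj w (hsphere w hw2 hw1) α
        rcases le_total s' β with h | h
        · exact Or.inl ⟨s', ⟨hs'.1, h⟩, rfl⟩
        · exact Or.inr ⟨s', ⟨h, hs'.2.le⟩, rfl⟩
      · rw [eq_empty_iff_forall_notMem]
        rintro w ⟨hwΩ, ⟨a, ha, rfl⟩, b, hb, hab⟩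
        have haE : a ∉ E := fun h => h hwΩ
        have hbE : b ∉ E := fun h => h (by rw [hab]; exact hwΩ)
        have haβ : a < β := lt_of_le_of_ne ha.2 fun h => haE (h ▸ hβm.1)
        have hαa : α < a := lt_of_le_of_ne ha.1 fun h => haE (h ▸ hαm.1)
        have := hθinj b a hab (by rw [abs_lt]; constructor <;> linarith [hb.1, hb.2])
        linarith [hb.1]
      · refine (convex_ball c r).isPreconnected.subset_closure
          (fun w hw => ⟨ball_subset_closedBall hw, hsub hw⟩) ?_
        rw [closure_ball c hr.ne']
        exact inter_subset_left
      · rintro w (hw | hw)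
        · exact ⟨hC₀Ω hw, hC₀i w hw⟩
        · exact ⟨hCΩ hw, hCi w hw⟩
      · rintro w ⟨hw1, hw2⟩
        exact ⟨hw2, hw1⟩
  have hexcl : ∀ t ∈ Ioo α β,
      Reaches Ω c r y (θ '' Ioo t β) (closedBall (q t) (Rad t)) →
        ¬ Reaches Ω c r y (θ '' Ioo α t) (closedBall (q t) (Rad t)) := by
    rintro t ht ⟨C₁, -, hC₁p, hC₁Ω, hC₁c, hC₁q, hyC₁, _, hz₁, ⟨s₂, hs₂, rfl⟩⟩
      ⟨C₂, -, hC₂p, hC₂Ω, hC₂c, hC₂q, hyC₂, _, hz₂, ⟨s₁, hs₁, rfl⟩⟩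
    obtain ⟨hR, -, hRn, -⟩ := hRad t ht
    obtain ⟨b, hbq, hb⟩ := not_subset.1 hRn
    refine hsc.false_of_joined_across_crosscut hΩ hr hR heΩ hec hb hbq hs₁.2 hs₂.1
      (fun s hs => harc s ⟨hs₁.1.trans_le hs.1, hs.2.trans_lt hs₂.2⟩)
      (by linarith [hs₁.1, hs₂.2]) (hC₁p.union y hyC₁ hyC₂ hC₂p) (union_subset hC₁Ω hC₂Ω)
      (disjoint_union_left.2 ⟨hC₁c, hC₂c⟩) (disjoint_union_left.2 ⟨hC₁q, hC₂q⟩)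
      (Or.inr hz₂) (Or.inl hz₁)
  have hev : ∀ t ∈ Ioo α β, ∀ C, IsCompact C → Disjoint C (closedBall (q t) (Rad t)) →
      ∀ᶠ t' in 𝓝 t, t' ∈ Ioo α β ∧ Disjoint C (closedBall (q t') (Rad t')) := by
    intro t ht C hC hd
    have h1 := eventually_disjoint_touching_closedBall (norm_squareDir t) (hRad t ht).2.2.2 hC hd
    filter_upwards [continuous_squareDir.continuousAt.eventually h1, Ioo_mem_nhds ht.1 ht.2]
      with t' h2 h3
    exact ⟨h3, h2 (norm_squareDir t') _ (hRad t' h3).2.1⟩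
  have hU : IsOpen {t | t ∈ Ioo α β ∧
      Reaches Ω c r y (θ '' Ioo t β) (closedBall (q t) (Rad t))} := by
    rw [isOpen_iff_mem_nhds]
    rintro t ⟨ht, C, h1, h2, h3, h4, h5, h6, _, hz, ⟨s, hs, rfl⟩⟩
    filter_upwards [hev t ht C h1 h5, Iio_mem_nhds hs.1] with t' h7 h8
    exact ⟨h7.1, C, h1, h2, h3, h4, h7.2, h6, θ s, hz, s, ⟨h8, hs.2⟩, rfl⟩
  have hW : IsOpen {t | t ∈ Ioo α β ∧
      Reaches Ω c r y (θ '' Ioo α t) (closedBall (q t) (Rad t))} := by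
    rw [isOpen_iff_mem_nhds]
    rintro t ⟨ht, C, h1, h2, h3, h4, h5, h6, _, hz, ⟨s, hs, rfl⟩⟩
    filter_upwards [hev t ht C h1 h5, Ioi_mem_nhds hs.2] with t' h7 h8
    exact ⟨h7.1, C, h1, h2, h3, h4, h7.2, h6, θ s, hz, s, ⟨hs.1, h8⟩, rfl⟩
  rcases isPreconnected_Ioo.subset_or_subset hU hW
      (disjoint_left.2 fun t h1 h2 => hexcl t h1.1 h1.2 h2.2)
      (fun t ht => (hcover t ht).imp (fun h => ⟨ht, h⟩) fun h => ⟨ht, h⟩) with hall | hall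
  · exact not_forall_reaches_ahead hr continuous_squareDir norm_squareDir (coversUpTo_squareDir β)
      hαβ hβm.1 Rad (fun t ht => (hRad t ht).1) (fun t ht => (hall ht).2)
      fun t ht => hexcl t ht (hall ht).2
  · -- The same argument with the orientation of the boundary reversed.
    have himg : ∀ a b, (fun s => c + r • squareDir (-s)) '' Ioo a b = θ '' Ioo (-b) (-a) := by
      intro a b
      rw [← image_neg_Ioo, image_image]
    have hneg : ∀ t ∈ Ioo (-β) (-α), -t ∈ Ioo α β := fun t ht =>
      ⟨by linarith [ht.2], by linarith [ht.1]⟩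
    refine not_forall_reaches_ahead (Ω := Ω) (y := y) (α := -β) (β := -α) hr
      (u := fun t => squareDir (-t))
      (continuous_squareDir.comp continuous_neg) (fun t => norm_squareDir (-t))
      (coversUpTo_squareDir_neg (-α)) (by linarith) (by rw [neg_neg]; exact hαm.1) (fun t => Rad (-t))
      (fun t ht => (hRad _ (hneg t ht)).1) (fun t ht => ?_) (fun t ht hr' => ?_)
    · rw [himg, neg_neg]
      exact (hall (hneg t ht)).2
    · rw [himg, neg_neg] at hr'
      exact hexcl _ (hneg t ht) hr' (hall (hneg t ht)).2

/-! ### Chains of touching squares -/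

/-- The squares with centres `c i` and radii `r i`, for `i ≤ N`, lie in `Ω`, consecutive ones touch
in `Ω`, those with `i < N` do not have `y` in their closure, and each of the latter except the
first separates its predecessor from `y` in `Ω`. -/
structure IsTouchingChain (Ω : Set (ℝ × ℝ)) (y : ℝ × ℝ) (c : ℕ → ℝ × ℝ) (r : ℕ → ℝ) (N : ℕ) :
    Prop where
  pos : ∀ i, 0 < r i
  subset : ∀ i, ball (c i) (r i) ⊆ Ω
  notMem : ∀ i < N, y ∉ closedBall (c i) (r i)
  dist_eq : ∀ i < N, dist (c i) (c (i + 1)) = r i + r (i + 1)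
  touch : ∀ i < N, (closedBall (c i) (r i) ∩ closedBall (c (i + 1)) (r (i + 1)) ∩ Ω).Nonempty
  separates : ∀ i < N, y ∉ closedBall (c (i + 1)) (r (i + 1)) →
    y ∉ connectedComponentIn (Ω \ closedBall (c (i + 1)) (r (i + 1))) (c i)

namespace IsTouchingChain

variable {Ω : Set (ℝ × ℝ)} {y : ℝ × ℝ} {c : ℕ → ℝ × ℝ} {r : ℕ → ℝ} {N : ℕ}

theorem center_mem (h : IsTouchingChain Ω y c r N) (i : ℕ) : c i ∈ ball (c i) (r i) :=
  mem_ball_self (h.pos i)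

theorem closure_ball (h : IsTouchingChain Ω y c r N) (i : ℕ) :
    closure (ball (c i) (r i)) = closedBall (c i) (r i) :=
  _root_.closure_ball _ (h.pos i).ne'

theorem isPreconnected_ball (_ : IsTouchingChain Ω y c r N) (i : ℕ) :
    IsPreconnected (ball (c i) (r i)) :=
  (convex_ball _ _).isPreconnected

theorem disjoint_consecutive (h : IsTouchingChain Ω y c r N) {i : ℕ} (hi : i < N) :
    Disjoint (ball (c i) (r i)) (closedBall (c (i + 1)) (r (i + 1))) :=
  ball_disjoint_closedBall (h.dist_eq i hi).ge

/-- The component of `y` outside the closure of a square does not meet the closure of the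
preceding square. -/
theorem disjoint_component (h : IsTouchingChain Ω y c r N) (hΩ : IsOpen Ω) {i : ℕ} (hi : i < N)
    (hy : y ∉ closedBall (c (i + 1)) (r (i + 1))) :
    Disjoint (connectedComponentIn (Ω \ closedBall (c (i + 1)) (r (i + 1))) y)
      (closedBall (c i) (r i)) := by
  set F := Ω \ closedBall (c (i + 1)) (r (i + 1))
  have hF : IsOpen F := hΩ.sdiff isClosed_closedBall
  rw [← h.closure_ball]
  refine Disjoint.closure_right (disjoint_left.2 fun w hw hwb => ?_) hF.connectedComponentIn
  have hsub : ball (c i) (r i) ⊆ F := fun z hz =>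
    ⟨h.subset i hz, disjoint_left.1 (h.disjoint_consecutive hi) hz⟩
  have h1 := connectedComponentIn_eq_of_isPreconnected (h.isPreconnected_ball i) hsub
    (h.center_mem i) hwb
  have h2 := connectedComponentIn_eq hw
  refine h.separates i hi hy ?_
  rw [h1, ← h2]
  exact mem_connectedComponentIn (connectedComponentIn_nonempty_iff.1 ⟨w, hw⟩)

/-- Outside the closure of a square of the chain, its successor lies in the component of `y`. -/
theorem ball_succ_subset (h : IsTouchingChain Ω y c r N) (hΩ : IsOpen Ω)
    (hconn : IsPreconnected Ω) (hyΩ : y ∈ Ω) {i : ℕ} (hi : i < N) :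
    ball (c (i + 1)) (r (i + 1)) ⊆ connectedComponentIn (Ω \ closedBall (c i) (r i)) y := by
  have hbF : ball (c (i + 1)) (r (i + 1)) ⊆ Ω \ closedBall (c i) (r i) := fun z hz =>
    ⟨h.subset _ hz, disjoint_left.1 (ball_disjoint_closedBall
      (by rw [dist_comm, h.dist_eq i hi, add_comm])) hz⟩
  by_cases hy : y ∈ closedBall (c (i + 1)) (r (i + 1))
  · have hp : IsPreconnected (insert y (ball (c (i + 1)) (r (i + 1)))) :=
      (h.isPreconnected_ball (i + 1)).subset_closure (subset_insert _ _) (by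
        rw [h.closure_ball]
        exact insert_subset hy ball_subset_closedBall)
    exact (subset_insert _ _).trans (hp.subset_connectedComponentIn (mem_insert _ _)
      (insert_subset ⟨hyΩ, h.notMem i hi⟩ hbF))
  · set F := Ω \ closedBall (c (i + 1)) (r (i + 1))
    have hF : IsOpen F := hΩ.sdiff isClosed_closedBall
    have hyF : y ∈ F := ⟨hyΩ, hy⟩
    set Y := connectedComponentIn F y
    have hYi : Disjoint Y (closedBall (c i) (r i)) := h.disjoint_component hΩ hi hy
    have hYp : IsPreconnected Y := isPreconnected_connectedComponentIn
    have hYF : Y ⊆ F := connectedComponentIn_subset F y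
    have hyY : y ∈ Y := mem_connectedComponentIn hyF
    have hr := h.pos (i + 1)
    -- The component `Y` accumulates at a point `p` of `Ω`, which lies in the square `i + 1`.
    obtain ⟨p, ⟨hpcl, hpΩ⟩, hpY⟩ : ∃ p ∈ closure Y ∩ Ω, p ∉ Y := by
      by_contra! hcon
      have := hconn.subset_of_closure_inter_subset hF.connectedComponentIn ⟨y, hyΩ, hyY⟩ hcon
      exact disjoint_left.1 hYi (this (h.subset i (h.center_mem i)))
        (mem_closedBall_self (h.pos i).le)
    have hpb : p ∈ closedBall (c (i + 1)) (r (i + 1)) := by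
      by_contra hpb
      refine hpY ?_
      have := connectedComponentIn_eq_of_mem_closure hΩ hr isPreconnected_singleton hYp
        (singleton_subset_iff.2 ⟨hpΩ, hpb⟩) hYF hpΩ (subset_closure rfl) hpcl rfl hyY
      change p ∈ connectedComponentIn F y
      rw [← this]
      exact mem_connectedComponentIn ⟨hpΩ, hpb⟩
    have hpi : p ∉ closedBall (c i) (r i) := by
      intro hpi
      have := connectedComponentIn_eq_of_mem_closure hΩ hr (h.isPreconnected_ball i) hYp
        (fun z hz => ⟨h.subset i hz, disjoint_left.1 (h.disjoint_consecutive hi) hz⟩) hYF hpΩ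
        (by rwa [h.closure_ball]) hpcl (h.center_mem i) hyY
      refine h.separates i hi hy ?_
      rw [this]
      exact hyY
    have h1 : IsPreconnected (insert p Y) :=
      hYp.subset_closure (subset_insert _ _) (insert_subset hpcl subset_closure)
    have h2 : IsPreconnected (insert p (ball (c (i + 1)) (r (i + 1)))) :=
      (h.isPreconnected_ball (i + 1)).subset_closure (subset_insert _ _) (by
        rw [h.closure_ball]
        exact insert_subset hpb ball_subset_closedBall)
    have h3 := (h1.union p (mem_insert _ _) (mem_insert _ _) h2).subset_connectedComponentIn
      (F := Ω \ closedBall (c i) (r i)) (Or.inl (mem_insert_of_mem _ hyY))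
      (union_subset (insert_subset ⟨hpΩ, hpi⟩ fun z hz => ⟨(hYF hz).1, disjoint_left.1 hYi hz⟩)
        (insert_subset ⟨hpΩ, hpi⟩ hbF))
    exact ((subset_insert _ _).trans subset_union_right).trans h3

theorem component_antitone (h : IsTouchingChain Ω y c r N) (hΩ : IsOpen Ω) (hyΩ : y ∈ Ω) {i j : ℕ}
    (hij : i ≤ j) (hj : j < N) :
    connectedComponentIn (Ω \ closedBall (c j) (r j)) y ⊆
      connectedComponentIn (Ω \ closedBall (c i) (r i)) y := by
  induction j, hij using Nat.le_induction with
  | base => exact Subset.rfl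
  | succ j hij ih =>
    refine Subset.trans ?_ (ih (by omega))
    have hy := h.notMem (j + 1) hj
    have hd := h.disjoint_component hΩ (show j < N by omega) hy
    exact isPreconnected_connectedComponentIn.subset_connectedComponentIn
      (mem_connectedComponentIn ⟨hyΩ, hy⟩)
      fun z hz => ⟨(connectedComponentIn_subset _ _ hz).1, disjoint_left.1 hd hz⟩

theorem ball_subset_component (h : IsTouchingChain Ω y c r N) (hΩ : IsOpen Ω)
    (hconn : IsPreconnected Ω) (hyΩ : y ∈ Ω) {i j : ℕ} (hij : i < j) (hj : j ≤ N) :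
    ball (c j) (r j) ⊆ connectedComponentIn (Ω \ closedBall (c i) (r i)) y := by
  obtain ⟨j, rfl⟩ : ∃ k, j = k + 1 := ⟨j - 1, by omega⟩
  exact (h.ball_succ_subset hΩ hconn hyΩ (by omega)).trans
    (h.component_antitone hΩ hyΩ (by omega) (by omega))

theorem disjoint_ball_closedBall (h : IsTouchingChain Ω y c r N) (hΩ : IsOpen Ω)
    (hconn : IsPreconnected Ω) (hyΩ : y ∈ Ω) {i j : ℕ} (hij : i < j) (hj : j ≤ N) :
    Disjoint (ball (c j) (r j)) (closedBall (c i) (r i)) :=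
  disjoint_left.2 fun _ hz =>
    (connectedComponentIn_subset _ _ (h.ball_subset_component hΩ hconn hyΩ hij hj hz)).2

theorem disjoint_ball_closedBall' (h : IsTouchingChain Ω y c r N) (hΩ : IsOpen Ω)
    (hconn : IsPreconnected Ω) (hyΩ : y ∈ Ω) {i j : ℕ} (hij : i < j) (hj : j ≤ N) :
    Disjoint (ball (c i) (r i)) (closedBall (c j) (r j)) := by
  rw [← h.closure_ball j]
  exact ((h.disjoint_ball_closedBall hΩ hconn hyΩ hij hj).mono_right
    ball_subset_closedBall).symm.closure_right isOpen_ball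

theorem component_ne (h : IsTouchingChain Ω y c r N) (hyΩ : y ∈ Ω) {m : ℕ} (hm : m + 1 < N) :
    connectedComponentIn (Ω \ closedBall (c (m + 1)) (r (m + 1))) (c m) ≠
      connectedComponentIn (Ω \ closedBall (c (m + 1)) (r (m + 1))) y := by
  intro he
  have hy := h.notMem (m + 1) hm
  refine h.separates m (by omega) hy ?_
  rw [he]
  exact mem_connectedComponentIn ⟨hyΩ, hy⟩

/-- Squares which are not consecutive do not touch in `Ω`, since a square between
them separates them. -/
theorem closedBall_inter_eq_empty (h : IsTouchingChain Ω y c r N) (hΩ : IsOpen Ω)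
    (hconn : IsPreconnected Ω) (hyΩ : y ∈ Ω) {l i : ℕ} (hli : l + 1 < i) (hi : i ≤ N) :
    closedBall (c l) (r l) ∩ closedBall (c i) (r i) ∩ Ω = ∅ := by
  rw [eq_empty_iff_forall_notMem]
  rintro p ⟨⟨hpl, hpi⟩, hpΩ⟩
  have hsub := h.ball_subset_component hΩ hconn hyΩ hli hi
  have h1 := connectedComponentIn_eq_of_mem_closure hΩ (h.pos (l + 1)) (h.isPreconnected_ball l)
    (h.isPreconnected_ball i)
    (fun z hz => ⟨h.subset l hz, disjoint_left.1 (h.disjoint_consecutive (by omega)) hz⟩)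
    (hsub.trans (connectedComponentIn_subset _ _)) hpΩ (by rwa [h.closure_ball])
    (by rwa [h.closure_ball]) (h.center_mem l) (h.center_mem i)
  have h2 := connectedComponentIn_eq (hsub (h.center_mem i))
  exact h.component_ne hyΩ (by omega) (h1.trans h2.symm)

/-- Outside the closure of a square of the chain, all earlier squares lie in the component of its
predecessor. -/
theorem ball_subset_component_pred (h : IsTouchingChain Ω y c r N) (hΩ : IsOpen Ω)
    (hconn : IsPreconnected Ω) (hyΩ : y ∈ Ω) {j m : ℕ} (hjm : j ≤ m) (hm : m + 1 ≤ N) :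
    ball (c j) (r j) ⊆ connectedComponentIn (Ω \ closedBall (c (m + 1)) (r (m + 1))) (c m) := by
  have hF : ∀ k ≤ m, ball (c k) (r k) ⊆ Ω \ closedBall (c (m + 1)) (r (m + 1)) := fun k hk z hz =>
    ⟨h.subset k hz, disjoint_left.1
      (h.disjoint_ball_closedBall' hΩ hconn hyΩ (Nat.lt_succ_of_le hk) hm) hz⟩
  have key : connectedComponentIn (Ω \ closedBall (c (m + 1)) (r (m + 1))) (c j) =
      connectedComponentIn (Ω \ closedBall (c (m + 1)) (r (m + 1))) (c m) := by
    induction hjm using Nat.decreasingInduction with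
    | self => rfl
    | of_succ k hk ih =>
      rw [← ih]
      obtain ⟨p, ⟨hp1, hp2⟩, hpΩ⟩ := h.touch k (by omega)
      exact connectedComponentIn_eq_of_mem_closure hΩ (h.pos (m + 1)) (h.isPreconnected_ball k)
        (h.isPreconnected_ball (k + 1)) (hF k hk.le) (hF (k + 1) hk) hpΩ
        (by rwa [h.closure_ball]) (by rwa [h.closure_ball]) (h.center_mem k) (h.center_mem (k + 1))
  rw [← key]
  exact (h.isPreconnected_ball j).subset_connectedComponentIn (h.center_mem j) (hF j hjm)

end IsTouchingChain

/-- There is no infinite chain of touching squares whose closures leave `Ω`: each of its squares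
meets a fixed path from the first square to `y`, so that the sizes of the squares are bounded
below, and they are disjoint subsets of a bounded set. -/
theorem exists_mem_closedBall_of_isTouchingChain {Ω : Set (ℝ × ℝ)} (hΩ : IsOpen Ω)
    (hconn : IsConnected Ω) (hbdd : Bornology.IsBounded Ω) {y : ℝ × ℝ} (hyΩ : y ∈ Ω)
    {c : ℕ → ℝ × ℝ} {r : ℕ → ℝ} (hnot : ∀ i, ¬ closedBall (c i) (r i) ⊆ Ω)
    (hchain : ∀ N, (∀ i < N, y ∉ closedBall (c i) (r i)) → IsTouchingChain Ω y c r N) :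
    ∃ i, y ∈ closedBall (c i) (r i) := by
  by_contra! hy
  have hN : ∀ N, IsTouchingChain Ω y c r N := fun N => hchain N fun i _ => hy i
  have hcΩ : ∀ i, c i ∈ Ω := fun i => (hN 0).subset i ((hN 0).center_mem i)
  obtain ⟨C, z, hC, hCp, hCΩ, hxC, hzC, hz, -⟩ :=
    exists_isCompact_isPreconnected_first_hit (F := Ω) (K := {y}) isClosed_singleton
      ((hΩ.isConnected_iff_isPathConnected.1 hconn).joinedIn (c 0) (hcΩ 0) y hyΩ)
      (fun h => hy 0 (by
        rw [← mem_singleton_iff.1 h]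
        exact mem_closedBall_self ((hN 0).pos 0).le)) rfl
  rw [mem_singleton_iff] at hz
  subst hz
  obtain ⟨δ, hδ, hδΩ⟩ := hC.exists_thickening_subset_open hΩ hCΩ
  have hr : ∀ m, δ / 2 ≤ r (m + 1) := by
    intro m
    have h := hN (m + 2)
    obtain ⟨p, hpC, hp⟩ : ∃ p ∈ C, p ∈ closedBall (c (m + 1)) (r (m + 1)) := by
      by_contra! hcon
      have h1 := connectedComponentIn_eq_of_isPreconnected
        (F := Ω \ closedBall (c (m + 1)) (r (m + 1))) hCp (fun w hw => ⟨hCΩ hw, hcon w hw⟩) hxC hzC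
      have h2 := connectedComponentIn_eq (h.ball_subset_component_pred hΩ hconn.isPreconnected hyΩ
        (Nat.zero_le m) (by omega) (h.center_mem 0))
      exact h.component_ne hyΩ (by omega) (h2.trans h1)
    obtain ⟨q, hq, hqΩ⟩ := not_subset.1 (hnot (m + 1))
    have h1 : δ ≤ dist q p := by
      by_contra! hlt
      exact hqΩ (hδΩ (mem_thickening_iff.2 ⟨p, hpC, hlt⟩))
    have h2 := dist_triangle_right q p (c (m + 1))
    rw [mem_closedBall] at hp hq
    linarith
  have hsep : ∀ i j, i < j → δ / 2 < dist (c (j + 1)) (c (i + 1)) := by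
    intro i j hij
    have := disjoint_left.1 ((hN (j + 1)).disjoint_ball_closedBall hΩ hconn.isPreconnected hyΩ
      (show i + 1 < j + 1 by omega) le_rfl) ((hN 0).center_mem (j + 1))
    rw [mem_closedBall, not_le] at this
    exact (hr i).trans_lt this
  obtain ⟨a, -, φ, hφ, ha⟩ := tendsto_subseq_of_bounded hbdd (fun n => hcΩ (n + 1))
  obtain ⟨n, hn⟩ := Metric.cauchySeq_iff'.1 ha.cauchySeq (δ / 2) (by positivity)
  exact absurd (hn (n + 1) (by omega)) (not_lt.2 (hsep _ _ (hφ (Nat.lt_succ_self n))).le)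

/-- The largest square in `Ω` with centre `x`. -/
theorem exists_maximal_ball {Ω : Set (ℝ × ℝ)} (hΩ : IsOpen Ω) (hbdd : Bornology.IsBounded Ω)
    {x : ℝ × ℝ} (hx : x ∈ Ω) : ∃ r, 0 < r ∧ ball x r ⊆ Ω ∧ ¬ closedBall x r ⊆ Ω := by
  have hne : Ωᶜ.Nonempty := by
    rw [nonempty_compl]
    rintro rfl
    exact NormedSpace.unbounded_univ ℝ (ℝ × ℝ) hbdd
  obtain ⟨e, he, hed⟩ := hΩ.isClosed_compl.exists_infDist_eq_dist hne x
  refine ⟨infDist x Ωᶜ, ?_, ball_infDist_compl_subset, fun h => he (h ?_)⟩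
  · exact (hΩ.isClosed_compl.notMem_iff_infDist_pos hne).1 (not_not.2 hx)
  · rw [mem_closedBall, dist_comm, hed]

theorem isOpenSquare_ball {c : ℝ × ℝ} {r : ℝ} (hr : 0 < r) : IsOpenSquare (ball c r) :=
  ⟨c, r, hr, by rw [← Real.ball_eq_Ioo, ← Real.ball_eq_Ioo, ball_prod_same]⟩

theorem mainTheorem6 (Ω : Set (ℝ × ℝ)) (hΩ_open : IsOpen Ω) (hΩ_conn : IsConnected Ω)
    (hΩ_sc : IsSimplyConnected Ω) (hΩ_bdd : Bornology.IsBounded Ω)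
    (x y : ℝ × ℝ) (hx : x ∈ Ω) (hy : y ∈ Ω) :
    ∃ (k : ℕ) (S : ℕ → Set (ℝ × ℝ)), 1 ≤ k ∧
      -- the members of the family `S 1, …, S k` are pairwise disjoint squares in `Ω`
      (∀ i ∈ Set.Icc 1 k, IsOpenSquare (S i) ∧ S i ⊆ Ω) ∧
      (Set.Icc 1 k).PairwiseDisjoint S ∧
      -- (i)
      x ∈ S 1 ∧ y ∈ closure (S k) ∧
      -- (ii)
      (∀ i : ℕ, 1 ≤ i → i + 1 ≤ k → (closure (S i) ∩ closure (S (i + 1)) ∩ Ω).Nonempty) ∧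
      (∀ i ∈ Set.Icc 1 k, ∀ j ∈ Set.Icc 1 k, 1 < |(i : ℤ) - (j : ℤ)| →
        closure (S i) ∩ closure (S j) ∩ Ω = ∅) ∧
      -- (iii)
      (∀ i : ℕ, 1 < i → i < k →
        ¬ IsConnected (Ω \ closure (S i)) ∧
        ∃ A B : Set (ℝ × ℝ),
          IsComponentOf A (Ω \ closure (S i)) ∧ IsComponentOf B (Ω \ closure (S i)) ∧ A ≠ B ∧
          (⋃ j ∈ Set.Ico 1 i, S j) ⊆ A ∧ (⋃ j ∈ Set.Ioc i k, S j) ⊆ B) := by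
  classical
  have hpre := hΩ_conn.isPreconnected
  -- A chain of squares is built by iteration, starting with the largest square around `x`.
  have hstep : ∀ p : (ℝ × ℝ) × ℝ, ∃ p' : (ℝ × ℝ) × ℝ,
      (0 < p.2 ∧ ball p.1 p.2 ⊆ Ω ∧ ¬ closedBall p.1 p.2 ⊆ Ω) →
      (0 < p'.2 ∧ ball p'.1 p'.2 ⊆ Ω ∧ ¬ closedBall p'.1 p'.2 ⊆ Ω) ∧
      (y ∉ closedBall p.1 p.2 → dist p.1 p'.1 = p.2 + p'.2 ∧
        (closedBall p.1 p.2 ∩ closedBall p'.1 p'.2 ∩ Ω).Nonempty ∧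
        (y ∉ closedBall p'.1 p'.2 →
          y ∉ connectedComponentIn (Ω \ closedBall p'.1 p'.2) p.1)) := by
    intro p
    by_cases hp : (0 < p.2 ∧ ball p.1 p.2 ⊆ Ω ∧ ¬ closedBall p.1 p.2 ⊆ Ω) ∧
        y ∉ closedBall p.1 p.2
    · obtain ⟨⟨h1, h2, h3⟩, h4⟩ := hp
      obtain ⟨c', r', g1, g2, g3, g4⟩ :=
        exists_touching_square hΩ_open hΩ_conn hΩ_sc hΩ_bdd h1 h2 h3 hy h4
      exact ⟨(c', r'), fun _ => ⟨⟨g1, g2, g3⟩, fun _ => g4⟩⟩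
    · exact ⟨p, fun h => ⟨h, fun h' => absurd ⟨h, h'⟩ hp⟩⟩
  choose next hnext using hstep
  obtain ⟨r₀, hr₀⟩ := exists_maximal_ball hΩ_open hΩ_bdd hx
  set s : ℕ → (ℝ × ℝ) × ℝ := fun n => next^[n] (x, r₀)
  have hs : ∀ n, s (n + 1) = next (s n) := fun n => Function.iterate_succ_apply' next n _
  have hgood : ∀ n, 0 < (s n).2 ∧ ball (s n).1 (s n).2 ⊆ Ω ∧ ¬ closedBall (s n).1 (s n).2 ⊆ Ω := by
    intro n
    induction n with
    | zero => exact hr₀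
    | succ n ih =>
      rw [hs]
      exact (hnext _ ih).1
  set c : ℕ → ℝ × ℝ := fun n => (s n).1
  set r : ℕ → ℝ := fun n => (s n).2
  have hchain : ∀ N, (∀ i < N, y ∉ closedBall (c i) (r i)) → IsTouchingChain Ω y c r N := by
    intro N hN
    have hrel : ∀ i < N, _ := fun i hi => (hnext (s i) (hgood i)).2 (hN i hi)
    simp only [← hs] at hrel
    exact ⟨fun i => (hgood i).1, fun i => (hgood i).2.1, hN, fun i hi => (hrel i hi).1,
      fun i hi => (hrel i hi).2.1, fun i hi => (hrel i hi).2.2⟩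
  have hex : ∃ i, y ∈ closedBall (c i) (r i) :=
    exists_mem_closedBall_of_isTouchingChain hΩ_open hΩ_conn hΩ_bdd hy
      (fun i => (hgood i).2.2) hchain
  set N := Nat.find hex
  have h : IsTouchingChain Ω y c r N := hchain N fun i hi => Nat.find_min hex hi
  refine ⟨N + 1, fun i => ball (c (i - 1)) (r (i - 1)), by omega,
    fun i _ => ⟨isOpenSquare_ball (h.pos _), h.subset _⟩, ?_, h.center_mem 0, ?_, ?_, ?_, ?_⟩
  · intro i hi j hj hij
    have key : ∀ a b, a < b → b ≤ N → Disjoint (ball (c a) (r a)) (ball (c b) (r b)) :=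
      fun a b hab hb => (h.disjoint_ball_closedBall' hΩ_open hpre hy hab hb).mono_right
        ball_subset_closedBall
    have hi' := hi.1
    have hi'' := hi.2
    have hj' := hj.1
    have hj'' := hj.2
    rcases lt_or_gt_of_ne hij with hlt | hlt
    · exact key (i - 1) (j - 1) (by omega) (by omega)
    · exact (key (j - 1) (i - 1) (by omega) (by omega)).symm
  · rw [h.closure_ball]
    exact Nat.find_spec hex
  · intro i hi hiN
    rw [h.closure_ball, h.closure_ball]
    obtain ⟨m, rfl⟩ : ∃ m, i = m + 1 := ⟨i - 1, by omega⟩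
    exact h.touch m (by omega)
  · intro i hi j hj hij
    rw [h.closure_ball, h.closure_ball]
    have hi' := hi.1
    have hi'' := hi.2
    have hj' := hj.1
    have hj'' := hj.2
    rcases lt_abs.1 hij with hlt | hlt
    · rw [inter_comm (closedBall _ _)]
      exact h.closedBall_inter_eq_empty hΩ_open hpre hy (by omega) (by omega)
    · exact h.closedBall_inter_eq_empty hΩ_open hpre hy (by omega) (by omega)
  · intro i hi hiN
    obtain ⟨m, rfl⟩ : ∃ m, i = m + 2 := ⟨i - 2, by omega⟩
    simp only [Nat.add_succ_sub_one, h.closure_ball]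
    have hm : m + 1 < N := by omega
    have hcF : c m ∈ Ω \ closedBall (c (m + 1)) (r (m + 1)) :=
      connectedComponentIn_subset _ _ (h.ball_subset_component_pred hΩ_open hpre hy le_rfl hm.le
        (h.center_mem m))
    have hyF : y ∈ Ω \ closedBall (c (m + 1)) (r (m + 1)) := ⟨hy, h.notMem _ hm⟩
    refine ⟨fun hc => h.component_ne hy hm (connectedComponentIn_eq_of_isPreconnected
      hc.isPreconnected Subset.rfl hcF hyF), _, _, ⟨c m, hcF, rfl⟩, ⟨y, hyF, rfl⟩,
      h.component_ne hy hm, iUnion₂_subset fun j hj => ?_, iUnion₂_subset fun j hj => ?_⟩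
    · have hj' := hj.1
      have hj'' := hj.2
      exact h.ball_subset_component_pred hΩ_open hpre hy (by omega) hm.le
    · have hj' := hj.1
      have hj'' := hj.2
      exact h.ball_subset_component hΩ_open hpre hy (by omega) (by omega)
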